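/- A \emph{real seminormed involutive algebra} $(A,p)$ is a real associative algebra $A$ (not necessarily unital) with a real-linear involutive antiautomorphism $a\mapsto a^*$ and a seminorm $p\colon A\to[0,\infty)$ such that $p(ab)\le p(a)p(b)$ and $p(a^*)=p(a)$ for all $a,b\in A$, and $p(\mathbf 1)=1$ if $A$ has an identity $\mathbf 1\neq 0$. A morphism $\eta\colon A\to C$ of real involutive algebras into a (complex) $C^*$-algebra $C$ is called \emph{the enveloping $C^*$-algebra of $(A,p)$} if $\|\eta(a)\|\le p(a)$ for all $a\in A$ and if for every $C^*$-algebra $B$ and every real-linear $*$-homomorphism $\beta\colon A\to B$ with $\|\beta(a)\|\le p(a)$ for all $a\in A$ there is a unique morphism of $C^*$-algebras $\tilde\beta\colon C\to B$ with $\tilde\beta\circ\eta=\beta$. It exists and is unique up to isomorphism (it is the Hausdorff completion of $\mathbb C\otimes_{\mathbb R}A$ with respect to the largest $C^*$-seminorm bounded by $p$ on $A$); it is denoted $\eta_A\colon A\to C^*(A,p)$. For $C^*$-algebras $C_1,C_2$, let $C_1\otimes C_2$ denote the maximal $C^*$-tensor product, i.e. the completion of the algebraic tensor product with respect to the largest $C^*$-seminorm.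 For seminormed involutive algebras $(A_1,p_1)$, $(A_2,p_2)$, the projective tensor product is the algebraic tensor product $A_1\otimes_{\mathbb R} A_2$ with $(a\otimes b)(a'\otimes b')=aa'\otimes bb'$, $(a\otimes b)^*=a^*\otimes b^*$ and $$(p_1\otimes p_2)(z)=\inf\Big\{\sum_j p_1(x_j)p_2(y_j)\colon z=\sum_j x_j\otimes y_j\Big\}.$$ \textbf{Proposition.} Let $(A_1,p_1)$ and $(A_2,p_2)$ be real seminormed involutive algebras. Then $(A_1\otimes A_2,p_1\otimes p_2)$ is a real seminormed involutive algebra, and the map $$\eta_{A_1}\otimes\eta_{A_2}\colon A_1\otimes A_2\to C^*(A_1,p_1)\otimes C^*(A_2,p_2)$$ is the enveloping $C^*$-algebra of $(A_1\otimes A_2,p_1\otimes p_2)$. \textbf{Corollary.} Let $(A,p)$ be a real seminormed involutive algebra and $n\in\mathbb N_0$. Then $\eta_A^{\otimes n}\colon A^{\otimes n}\to C^*(A,p)^{\otimes n}$ is the enveloping $C^*$-algebra of the seminormed involutive algebra $(A^{\otimes n},p^{\otimes n})$. Here $A^{\otimes 1}=A$, $A^{\otimes (n+1)}=A^{\otimes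 n}\otimes A$ for $n\ge1$, and likewise for $p^{\otimes n}$, $\eta_A^{\otimes n}$ and for the maximal $C^*$-tensor powers $C^*(A,p)^{\otimes n}$; for $n=0$ the map $\eta_A^{\otimes 0}$ is the inclusion of $(\mathbb R,|\cdot|)$ into $\mathbb C$. -/

import Mathlib

open scoped TensorProduct

universe u u₁ u₂ w

noncomputable section

namespace EnvCStar

/-! ### The involution on a tensor product of (possibly non-unital) algebras -/

section StarTensor

variable {R A B : Type*} [CommSemiring R] [StarRing R]
  [NonUnitalSemiring A] [Module R A] [SMulCommClass R A A] [IsScalarTower R A A]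
  [StarRing A] [StarModule R A]
  [NonUnitalSemiring B] [Module R B] [SMulCommClass R B B] [IsScalarTower R B B]
  [StarRing B] [StarModule R B]

/-- The involution `(a ⊗ b)* = a* ⊗ b*` makes the tensor product algebra an involutive algebra. -/
instance tensorStarRing : StarRing (A ⊗[R] B) where
  star_mul x y := by
    induction x with
    | zero => simp
    | add x x' hx hx' => rw [add_mul, star_add, hx, hx', star_add, mul_add]
    | tmul a b =>
      induction y with
      | zero => simp
      | add y y' hy hy' => rw [mul_add, star_add, hy, hy', star_add, add_mul]
      | tmul c d => simp [Algebra.TensorProduct.tmul_mul_tmul]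
  star_add := star_add

end StarTensor

instance complexificationStarModule {A : Type*} [NonUnitalRing A] [Module ℝ A]
    [SMulCommClass ℝ A A] [IsScalarTower ℝ A A] [StarRing A] [StarModule ℝ A] :
    StarModule ℂ (ℂ ⊗[ℝ] A) where
  star_smul z x := by
    induction x with
    | zero => simp
    | add x y hx hy => rw [smul_add, star_add, hx, hy, star_add, smul_add]
    | tmul c a => simp [TensorProduct.smul_tmul']

/-! ### Real seminormed involutive algebras and the projective tensor product -/

/-- `p` is a submultiplicative involutive seminorm on the real involutive algebra `A`,
with `p 1 = 1` in case `A` has an identity element `1 ≠ 0`. -/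
structure IsInvolutiveSeminorm {A : Type*} [NonUnitalRing A] [Module ℝ A] [StarRing A]
    (p : Seminorm ℝ A) : Prop where
  mul_le : ∀ a b, p (a * b) ≤ p a * p b
  star_eq : ∀ a, p (star a) = p a
  identity_eq_one : ∀ e : A, e ≠ 0 → (∀ a, e * a = a ∧ a * e = a) → p e = 1

section Projective

variable {A : Type*} {B : Type*} [AddCommGroup A] [Module ℝ A] [AddCommGroup B] [Module ℝ B]

/-- The set of all values `∑ⱼ p(xⱼ) q(yⱼ)` over the finite representations `z = ∑ⱼ xⱼ ⊗ yⱼ`. -/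
def reprValues (p : Seminorm ℝ A) (q : Seminorm ℝ B) (z : A ⊗[ℝ] B) : Set ℝ :=
  {r | ∃ l : List (A × B), (l.map fun t => t.1 ⊗ₜ[ℝ] t.2).sum = z ∧
    r = (l.map fun t => p t.1 * q t.2).sum}

theorem reprValues_nonneg (p : Seminorm ℝ A) (q : Seminorm ℝ B) (z : A ⊗[ℝ] B) :
    ∀ r ∈ reprValues p q z, 0 ≤ r := by
  rintro r ⟨l, -, rfl⟩
  refine List.sum_nonneg ?_
  intro x hx
  obtain ⟨t, -, rfl⟩ := List.mem_map.1 hx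
  exact mul_nonneg (apply_nonneg _ _) (apply_nonneg _ _)

theorem reprValues_bddBelow (p : Seminorm ℝ A) (q : Seminorm ℝ B) (z : A ⊗[ℝ] B) :
    BddBelow (reprValues p q z) := ⟨0, reprValues_nonneg p q z⟩

theorem reprValues_add {p : Seminorm ℝ A} {q : Seminorm ℝ B} {z z' : A ⊗[ℝ] B} {r r' : ℝ}
    (h : r ∈ reprValues p q z) (h' : r' ∈ reprValues p q z') :
    r + r' ∈ reprValues p q (z + z') := by
  obtain ⟨l, rfl, rfl⟩ := h
  obtain ⟨l', rfl, rfl⟩ := h'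
  exact ⟨l ++ l', by simp, by simp⟩

theorem reprValues_smul {p : Seminorm ℝ A} {q : Seminorm ℝ B} {z : A ⊗[ℝ] B} {r : ℝ}
    (c : ℝ) (h : r ∈ reprValues p q z) : ‖c‖ * r ∈ reprValues p q (c • z) := by
  obtain ⟨l, rfl, rfl⟩ := h
  refine ⟨l.map fun t => (c • t.1, t.2), ?_, ?_⟩
  · rw [List.smul_sum, List.map_map, List.map_map]
    rfl
  · rw [← List.sum_map_mul_left, List.map_map]
    congr 2
    funext t
    simp [map_smul_eq_mul, mul_assoc]

theorem reprValues_nonempty (p : Seminorm ℝ A) (q : Seminorm ℝ B) (z : A ⊗[ℝ] B) :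
    (reprValues p q z).Nonempty := by
  induction z with
  | zero => exact ⟨0, [], by simp, by simp⟩
  | tmul a b => exact ⟨_, [(a, b)], by simp, rfl⟩
  | add z z' hz hz' =>
    obtain ⟨r, hr⟩ := hz
    obtain ⟨r', hr'⟩ := hz'
    exact ⟨_, reprValues_add hr hr'⟩

/-- The projective tensor product `p ⊗ q` of two seminorms:
`(p ⊗ q)(z) = inf {∑ⱼ p(xⱼ) q(yⱼ) : z = ∑ⱼ xⱼ ⊗ yⱼ}`. -/
def projSeminorm (p : Seminorm ℝ A) (q : Seminorm ℝ B) : Seminorm ℝ (A ⊗[ℝ] B) :=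
  Seminorm.ofSMulLE (fun z => sInf (reprValues p q z))
    (le_antisymm (csInf_le (reprValues_bddBelow p q 0) ⟨[], by simp, by simp⟩)
      (le_csInf (reprValues_nonempty p q 0) (reprValues_nonneg p q 0)))
    (fun z z' => by
      refine le_of_forall_pos_le_add fun ε hε => ?_
      obtain ⟨r, hr, hr1⟩ := exists_lt_of_csInf_lt (reprValues_nonempty p q z)
        (lt_add_of_pos_right (sInf (reprValues p q z)) (half_pos hε))
      obtain ⟨r', hr', hr1'⟩ := exists_lt_of_csInf_lt (reprValues_nonempty p q z')
        (lt_add_of_pos_right (sInf (reprValues p q z')) (half_pos hε))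
      have := csInf_le (reprValues_bddBelow p q (z + z')) (reprValues_add hr hr')
      linarith)
    (fun c z => by
      rw [← smul_eq_mul, ← Real.sInf_smul_of_nonneg (norm_nonneg c)]
      refine csInf_le_csInf (reprValues_bddBelow p q _) (reprValues_nonempty p q z).smul_set ?_
      rintro _ ⟨r, hr, rfl⟩
      exact reprValues_smul c hr)

end Projective

/-! ### C*-seminorms and their completions -/

section Completion

/-- A C*-seminorm on a complex involutive algebra `D`: a submultiplicative seminorm with
`q (x* x) = q x ^ 2`. -/
structure CStarSeminorm (D : Type*) [NonUnitalRing D] [Module ℂ D] [StarRing D] extends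
    Seminorm ℂ D where
  mul_le : ∀ x y, toSeminorm (x * y) ≤ toSeminorm x * toSeminorm y
  star_mul_self : ∀ x, toSeminorm (star x * x) = toSeminorm x ^ 2

variable {D : Type*} [NonUnitalRing D] [Module ℂ D] [StarRing D]

instance : CoeFun (CStarSeminorm D) fun _ => D → ℝ := ⟨fun q => ⇑q.toSeminorm⟩

theorem CStarSeminorm.star_eq (q : CStarSeminorm D) (x : D) : q (star x) = q x := by
  have key : ∀ y : D, q y ≤ q (star y) := by
    intro y
    have h1 := q.star_mul_self y
    have h2 := q.mul_le (star y) y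
    have h3 : 0 ≤ q y := apply_nonneg _ _
    have h4 : 0 ≤ q (star y) := apply_nonneg _ _
    by_contra! h
    nlinarith
  refine le_antisymm ?_ (key x)
  simpa using key (star x)

/-- The pointwise supremum of a (pointwise bounded) set of C*-seminorms is a C*-seminorm.
(If the set were not pointwise bounded, this would be the zero seminorm.) -/
def CStarSeminorm.sup (S : Set (CStarSeminorm D)) : CStarSeminorm D where
  toSeminorm := sSup (CStarSeminorm.toSeminorm '' S)
  mul_le x y := by
    by_cases h : BddAbove (CStarSeminorm.toSeminorm '' S)
    · have hb : ∀ z, BddAbove (Set.range fun p : ↥(CStarSeminorm.toSeminorm '' S) =>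
          (p : Seminorm ℂ D) z) := by
        obtain ⟨q, hq⟩ := h
        rintro z
        refine ⟨q z, ?_⟩
        rintro _ ⟨p, rfl⟩
        exact hq p.2 z
      rw [Seminorm.sSup_apply h, Seminorm.sSup_apply h, Seminorm.sSup_apply h]
      refine Real.iSup_le ?_ (mul_nonneg (Real.iSup_nonneg fun _ => apply_nonneg _ _)
        (Real.iSup_nonneg fun _ => apply_nonneg _ _))
      rintro ⟨_, q, hq, rfl⟩
      refine (q.mul_le x y).trans ?_
      exact mul_le_mul (le_ciSup (hb x) ⟨_, q, hq, rfl⟩) (le_ciSup (hb y) ⟨_, q, hq, rfl⟩)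
        (apply_nonneg _ _) (Real.iSup_nonneg fun _ => apply_nonneg _ _)
    · have h0 : sSup (CStarSeminorm.toSeminorm '' S) = ⊥ :=
        dif_neg (fun h' => h (Seminorm.bddAbove_iff.2 h'))
      simp [h0]
  star_mul_self x := by
    by_cases h : BddAbove (CStarSeminorm.toSeminorm '' S)
    · have hb : ∀ z, BddAbove (Set.range fun p : ↥(CStarSeminorm.toSeminorm '' S) =>
          (p : Seminorm ℂ D) z) := by
        obtain ⟨q, hq⟩ := h
        rintro z
        refine ⟨q z, ?_⟩
        rintro _ ⟨p, rfl⟩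
        exact hq p.2 z
      rw [Seminorm.sSup_apply h, Seminorm.sSup_apply h]
      refine le_antisymm ?_ ?_
      · refine Real.iSup_le ?_ (sq_nonneg _)
        rintro ⟨_, q, hq, rfl⟩
        refine (q.star_mul_self x).le.trans ?_
        exact pow_le_pow_left₀ (apply_nonneg _ _) (le_ciSup (hb x) ⟨_, q, hq, rfl⟩) 2
      · refine (Real.le_sqrt (Real.iSup_nonneg fun _ => apply_nonneg _ _)
          (Real.iSup_nonneg fun _ => apply_nonneg _ _)).1 ?_
        refine Real.iSup_le ?_ (Real.sqrt_nonneg _)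
        rintro ⟨_, q, hq, rfl⟩
        refine Real.le_sqrt_of_sq_le ?_
        refine (q.star_mul_self x).ge.trans ?_
        exact le_ciSup (hb (star x * x)) ⟨_, q, hq, rfl⟩
    · have h0 : sSup (CStarSeminorm.toSeminorm '' S) = ⊥ :=
        dif_neg (fun h' => h (Seminorm.bddAbove_iff.2 h'))
      simp [h0]

theorem CStarSeminorm.le_sup {S : Set (CStarSeminorm D)} {M : D → ℝ}
    (hM : ∀ q ∈ S, ∀ x, q x ≤ M x) {q : CStarSeminorm D} (hq : q ∈ S) (x : D) :
    q x ≤ CStarSeminorm.sup S x := by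
  have h : BddAbove (CStarSeminorm.toSeminorm '' S) := by
    refine Seminorm.bddAbove_iff.2 ⟨M, ?_⟩
    rintro _ ⟨_, ⟨q', hq', rfl⟩, rfl⟩ y
    exact hM q' hq' y
  change _ ≤ (sSup (CStarSeminorm.toSeminorm '' S)) x
  rw [Seminorm.sSup_apply h]
  refine le_ciSup (f := fun p : ↥(CStarSeminorm.toSeminorm '' S) => (p : Seminorm ℂ D) x)
    ⟨M x, ?_⟩ ⟨_, q, hq, rfl⟩
  rintro _ ⟨⟨_, q', hq', rfl⟩, rfl⟩
  exact hM q' hq' x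

theorem CStarSeminorm.sup_le {S : Set (CStarSeminorm D)} {x : D} {c : ℝ} (hc : 0 ≤ c)
    (h : ∀ q ∈ S, q x ≤ c) : CStarSeminorm.sup S x ≤ c := by
  change (sSup (CStarSeminorm.toSeminorm '' S)) x ≤ c
  by_cases hb : BddAbove (CStarSeminorm.toSeminorm '' S)
  · rw [Seminorm.sSup_apply hb]
    refine Real.iSup_le ?_ hc
    rintro ⟨_, q, hq, rfl⟩
    exact h q hq
  · have h0 : sSup (CStarSeminorm.toSeminorm '' S) = ⊥ :=
      dif_neg (fun h' => hb (Seminorm.bddAbove_iff.2 h'))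
    simpa [h0] using hc

/-- The algebra `D`, regarded as a seminormed algebra with the C*-seminorm `q`. -/
def WithSeminorm (_q : CStarSeminorm D) : Type _ := D

variable (q : CStarSeminorm D)

instance : NonUnitalRing (WithSeminorm q) := inferInstanceAs (NonUnitalRing D)
instance : Module ℂ (WithSeminorm q) := inferInstanceAs (Module ℂ D)
instance : StarRing (WithSeminorm q) := inferInstanceAs (StarRing D)

instance : SeminormedAddCommGroup (WithSeminorm q) :=
  AddGroupSeminorm.toSeminormedAddCommGroup (E := WithSeminorm q) q.toSeminorm.toAddGroupSeminorm

instance : NonUnitalSeminormedRing (WithSeminorm q) where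
  __ := (inferInstance : SeminormedAddCommGroup (WithSeminorm q))
  __ := (inferInstance : NonUnitalRing (WithSeminorm q))
  norm_mul_le := q.mul_le

theorem WithSeminorm.norm_def (x : WithSeminorm q) : ‖x‖ = q x := rfl

instance : NormedSpace ℂ (WithSeminorm q) where
  norm_smul_le c x := (map_smul_eq_mul q.toSeminorm c x).le

instance : NormedStarGroup (WithSeminorm q) where
  norm_star_le x := (q.star_eq x).le

/-- The C*-algebra obtained from `(D, q)` by (Hausdorff) completion. -/
def CStarCompletion : Type _ := UniformSpace.Completion (WithSeminorm q)

namespace CStarCompletion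

open UniformSpace

instance : NormedAddCommGroup (CStarCompletion q) :=
  inferInstanceAs (NormedAddCommGroup (Completion (WithSeminorm q)))
instance : NormedSpace ℂ (CStarCompletion q) :=
  inferInstanceAs (NormedSpace ℂ (Completion (WithSeminorm q)))
instance : CompleteSpace (CStarCompletion q) :=
  inferInstanceAs (CompleteSpace (Completion (WithSeminorm q)))

/-- The canonical map of `D` into the completion. -/
def mk (x : D) : CStarCompletion q := Completion.coe' (α := WithSeminorm q) x

theorem denseRange_mk : DenseRange (mk q) :=
  Completion.denseRange_coe (α := WithSeminorm q)

theorem norm_mk (x : D) : ‖mk q x‖ = q x := Completion.norm_coe (E := WithSeminorm q) x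

theorem mk_add (x y : D) : mk q (x + y) = mk q x + mk q y :=
  Completion.coe_add (α := WithSeminorm q) x y

theorem mk_zero : mk q 0 = 0 := Completion.coe_zero (α := WithSeminorm q)

theorem mk_smul (c : ℂ) (x : D) : mk q (c • x) = c • mk q x :=
  Completion.coe_smul (X := WithSeminorm q) c x

theorem induction {P : CStarCompletion q → Prop} (hP : IsClosed {x | P x})
    (h : ∀ x, P (mk q x)) (x : CStarCompletion q) : P x :=
  Completion.induction_on (α := WithSeminorm q) x hP h

theorem induction₂ {P : CStarCompletion q → CStarCompletion q → Prop}
    (hP : IsClosed {x : CStarCompletion q × CStarCompletion q | P x.1 x.2})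
    (h : ∀ x y, P (mk q x) (mk q y)) (x y : CStarCompletion q) : P x y :=
  Completion.induction_on₂ (α := WithSeminorm q) (β := WithSeminorm q) x y hP h

theorem induction₃ {P : CStarCompletion q → CStarCompletion q → CStarCompletion q → Prop}
    (hP : IsClosed {x : CStarCompletion q × CStarCompletion q × CStarCompletion q |
      P x.1 x.2.1 x.2.2})
    (h : ∀ x y z, P (mk q x) (mk q y) (mk q z)) (x y z : CStarCompletion q) : P x y z :=
  Completion.induction_on₃ (α := WithSeminorm q) (β := WithSeminorm q) (γ := WithSeminorm q)
    x y z hP h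

/-- Multiplication on the completion: the continuous extension of the multiplication of `D`. -/
instance : Mul (CStarCompletion q) where
  mul := Function.curry <| ((Completion.isDenseInducing_coe (α := WithSeminorm q)).prodMap
    (Completion.isDenseInducing_coe (α := WithSeminorm q))).extend
      ((fun x => (x : Completion (WithSeminorm q))) ∘ Function.uncurry (· * ·))

theorem mk_mul (x y : D) : mk q (x * y) = mk q x * mk q y :=
  (((Completion.isDenseInducing_coe (α := WithSeminorm q)).prodMap
    (Completion.isDenseInducing_coe (α := WithSeminorm q))).extend_eq
      ((Completion.continuous_coe (WithSeminorm q)).comp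
        (continuous_mul (M := WithSeminorm q))) (x, y)).symm

instance : ContinuousMul (CStarCompletion q) where
  continuous_mul := by
    let m := (AddMonoidHom.mul : WithSeminorm q →+ WithSeminorm q →+ WithSeminorm q).compr₂
      Completion.toCompl
    have hm : Continuous fun p : WithSeminorm q × WithSeminorm q => m p.1 p.2 :=
      (Completion.continuous_coe (WithSeminorm q)).comp continuous_mul
    have di : IsDenseInducing
      (Completion.toCompl : WithSeminorm q → Completion (WithSeminorm q)) :=
      Completion.isDenseInducing_coe
    exact (di.extend_Z_bilin di hm :)

/-- The involution on the completion: the continuous extension of the involution of `D`. -/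
instance : Star (CStarCompletion q) where
  star := Completion.map (star : WithSeminorm q → WithSeminorm q)

theorem mk_star (x : D) : mk q (star x) = star (mk q x) :=
  (Completion.map_coe (star_isometry (E := WithSeminorm q)).uniformContinuous x).symm

instance : ContinuousStar (CStarCompletion q) where
  continuous_star := Completion.continuous_map

instance : NonUnitalRing (CStarCompletion q) where
  __ := (inferInstance : AddCommGroup (CStarCompletion q))
  __ := (inferInstance : Mul (CStarCompletion q))
  zero_mul := induction q (isClosed_eq (by fun_prop) (by fun_prop))
    fun a => by rw [← mk_zero, ← mk_mul, zero_mul]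
  mul_zero := induction q (isClosed_eq (by fun_prop) (by fun_prop))
    fun a => by rw [← mk_zero, ← mk_mul, mul_zero]
  mul_assoc := induction₃ q (isClosed_eq (by fun_prop) (by fun_prop))
    fun a b c => by simp only [← mk_mul, mul_assoc]
  left_distrib := induction₃ q (isClosed_eq (by fun_prop) (by fun_prop))
    fun a b c => by simp only [← mk_mul, ← mk_add, mul_add]
  right_distrib := induction₃ q (isClosed_eq (by fun_prop) (by fun_prop))
    fun a b c => by simp only [← mk_mul, ← mk_add, add_mul]

instance : NonUnitalNormedRing (CStarCompletion q) where
  __ := (inferInstance : NormedAddCommGroup (CStarCompletion q))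
  __ := (inferInstance : NonUnitalRing (CStarCompletion q))
  norm_mul_le := induction₂ q (isClosed_le (by fun_prop) (by fun_prop))
    fun a b => by simpa only [← mk_mul, norm_mk] using q.mul_le a b

instance : StarRing (CStarCompletion q) where
  star_involutive := induction q (isClosed_eq (by fun_prop) (by fun_prop))
    fun a => by simp only [← mk_star, star_star]
  star_mul := induction₂ q (isClosed_eq (by fun_prop) (by fun_prop))
    fun a b => by simp only [← mk_star, ← mk_mul, star_mul]
  star_add := induction₂ q (isClosed_eq (by fun_prop) (by fun_prop))
    fun a b => by simp only [← mk_star, ← mk_add, star_add]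

variable [IsScalarTower ℂ D D] [SMulCommClass ℂ D D] [StarModule ℂ D]

instance : CStarRing (CStarCompletion q) where
  norm_mul_self_le := induction q
    (isClosed_le (continuous_norm.mul continuous_norm)
      (continuous_norm.comp (continuous_star.mul continuous_id)))
    fun a => by
      rw [← mk_star, ← mk_mul, norm_mk, norm_mk, q.star_mul_self, pow_two]

instance : IsScalarTower ℂ (CStarCompletion q) (CStarCompletion q) where
  smul_assoc c := induction₂ q
    (isClosed_eq ((continuous_fst.const_smul c).mul continuous_snd)
      ((continuous_fst.mul continuous_snd).const_smul c))
    fun a b => by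
      rw [smul_eq_mul, smul_eq_mul, ← mk_smul, ← mk_mul, ← mk_mul, ← mk_smul, smul_mul_assoc]

instance : SMulCommClass ℂ (CStarCompletion q) (CStarCompletion q) where
  smul_comm c := induction₂ q
    (isClosed_eq ((continuous_fst.mul continuous_snd).const_smul c)
      (continuous_fst.mul (continuous_snd.const_smul c)))
    fun a b => by
      rw [smul_eq_mul, smul_eq_mul, ← mk_smul, ← mk_mul, ← mk_mul, ← mk_smul, mul_smul_comm]

instance : StarModule ℂ (CStarCompletion q) where
  star_smul c := induction q
    (isClosed_eq (continuous_star.comp (continuous_const_smul c))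
      (continuous_star.const_smul (star c)))
    fun a => by rw [← mk_smul, ← mk_star, ← mk_star, ← mk_smul, star_smul]

instance : NonUnitalCStarAlgebra (CStarCompletion q) where

/-- The canonical map of `D` into the completion, as a morphism of involutive algebras. -/
def mkHom : D →⋆ₙₐ[ℂ] CStarCompletion q where
  toFun := mk q
  map_smul' := mk_smul q
  map_zero' := mk_zero q
  map_add' := mk_add q
  map_mul' := mk_mul q
  map_star' := mk_star q

variable {q} {B : Type*} [NonUnitalCStarAlgebra B]

theorem hom_ext {f g : CStarCompletion q →⋆ₙₐ[ℂ] B} (h : ∀ x, f (mk q x) = g (mk q x)) :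
    f = g := by
  have hc : ∀ k : CStarCompletion q →⋆ₙₐ[ℂ] B, Continuous k := fun k =>
    AddMonoidHomClass.continuous_of_bound k 1 fun x => by
      simpa using NonUnitalStarAlgHom.norm_apply_le k x
  exact DFunLike.ext _ _ (induction q (isClosed_eq (hc f) (hc g)) h)

/-- The continuous extension to the completion of a map on `D`. -/
def extendFun (q : CStarSeminorm D) (φ : D → B) : CStarCompletion q → B :=
  Completion.extension (α := WithSeminorm q) φ

theorem continuous_extendFun (q : CStarSeminorm D) (φ : D → B) : Continuous (extendFun q φ) :=
  Completion.continuous_extension (α := WithSeminorm q)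

theorem extendFun_mk (q : CStarSeminorm D) (φ : D →⋆ₙₐ[ℂ] B) (h : ∀ x, ‖φ x‖ ≤ q x) (x : D) :
    extendFun q φ (mk q x) = φ x := by
  let φ' : WithSeminorm q →+ B :=
    { toFun := φ, map_zero' := map_zero φ, map_add' := map_add φ }
  have hb : ∀ x : WithSeminorm q, ‖φ' x‖ ≤ 1 * ‖x‖ := fun x => by
    rw [one_mul]
    exact h x
  exact Completion.extension_coe (α := WithSeminorm q) (uniformContinuous_addMonoidHom_of_continuous
    (AddMonoidHomClass.continuous_of_bound φ' 1 hb)) x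

/-- A `q`-contractive morphism of `D` into a C*-algebra extends to the completion. -/
def lift (q : CStarSeminorm D) (φ : D →⋆ₙₐ[ℂ] B) (h : ∀ x, ‖φ x‖ ≤ q x) :
    CStarCompletion q →⋆ₙₐ[ℂ] B :=
  have hc : Continuous (extendFun q φ) := continuous_extendFun q φ
  have he : ∀ x, extendFun q φ (mk q x) = φ x := extendFun_mk q φ h
  { toFun := extendFun q φ
    map_smul' := fun c => induction q
      (isClosed_eq (hc.comp (continuous_const_smul c)) (hc.const_smul c))
      fun x => by rw [← mk_smul, he, he, map_smul]; rfl
    map_zero' := by rw [← mk_zero, he, map_zero]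
    map_add' := induction₂ q
      (isClosed_eq (hc.comp (continuous_fst.add continuous_snd))
        ((hc.comp continuous_fst).add (hc.comp continuous_snd)))
      fun x y => by rw [← mk_add, he, he, he, map_add]
    map_mul' := induction₂ q
      (isClosed_eq (hc.comp (continuous_fst.mul continuous_snd))
        ((hc.comp continuous_fst).mul (hc.comp continuous_snd)))
      fun x y => by rw [← mk_mul, he, he, he, map_mul]
    map_star' := induction q
      (isClosed_eq (hc.comp continuous_star) (continuous_star.comp hc))
      fun x => by rw [← mk_star, he, he, map_star] }

theorem lift_mk (q : CStarSeminorm D) (φ : D →⋆ₙₐ[ℂ] B) (h : ∀ x, ‖φ x‖ ≤ q x) (x : D) :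
    lift q φ h (mk q x) = φ x := extendFun_mk q φ h x

end CStarCompletion

end Completion

/-! ### Enveloping C*-algebras -/

section Enveloping

variable {A : Type u} [NonUnitalRing A] [Module ℝ A] [IsScalarTower ℝ A A] [SMulCommClass ℝ A A]
  [StarRing A] [StarModule ℝ A]

/-- The universal property of the enveloping C*-algebra of `(A, p)`: the morphism
`η : A → C` of real involutive algebras satisfies `‖η a‖ ≤ p a`, and every morphism `β : A → B` of
real involutive algebras into a C*-algebra `B` with `‖β a‖ ≤ p a` factors through a unique morphism
`C → B` of C*-algebras. -/
def IsEnvelopingCStar {C : Type*} [NonUnitalCStarAlgebra C] (p : Seminorm ℝ A)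
    (η : A →⋆ₙₐ[ℝ] C) : Prop :=
  (∀ a, ‖η a‖ ≤ p a) ∧
    ∀ (B : Type w) [NonUnitalCStarAlgebra B] (β : A →⋆ₙₐ[ℝ] B), (∀ a, ‖β a‖ ≤ p a) →
      ∃! β' : C →⋆ₙₐ[ℂ] B, ∀ a, β' (η a) = β a

/-- The largest C*-seminorm on the complexification `ℂ ⊗ A` which is bounded by `p` on `A`. -/
def envelopingSeminorm (p : Seminorm ℝ A) : CStarSeminorm (ℂ ⊗[ℝ] A) :=
  CStarSeminorm.sup {q | ∀ a : A, q ((1 : ℂ) ⊗ₜ[ℝ] a) ≤ p a}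

/-- The enveloping C*-algebra `C*(A, p)`: the completion of the complexification of `A` with
respect to the largest C*-seminorm which is bounded by `p` on `A`. -/
abbrev EnvelopingCStar (p : Seminorm ℝ A) : Type u := CStarCompletion (envelopingSeminorm p)

/-- The canonical morphism `η_A : A → C*(A, p)`. -/
def toEnveloping (p : Seminorm ℝ A) : A →⋆ₙₐ[ℝ] EnvelopingCStar p where
  toFun a := CStarCompletion.mkHom (envelopingSeminorm p) ((1 : ℂ) ⊗ₜ[ℝ] a)
  map_smul' r a := by
    have h : (1 : ℂ) ⊗ₜ[ℝ] (r • a) = (r : ℂ) • ((1 : ℂ) ⊗ₜ[ℝ] a) := by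
      rw [← TensorProduct.smul_tmul, TensorProduct.smul_tmul']
      simp
    rw [h, map_smul]
    rfl
  map_zero' := by simp
  map_add' a b := by rw [TensorProduct.tmul_add, map_add]
  map_mul' a b := by
    rw [← map_mul, Algebra.TensorProduct.tmul_mul_tmul, one_mul]
  map_star' a := by
    rw [← map_star, TensorProduct.star_tmul, star_one]

theorem envelopingSeminorm_bound (p : Seminorm ℝ A) (x : ℂ ⊗[ℝ] A) :
    ∃ M : ℝ, ∀ q ∈ {q : CStarSeminorm (ℂ ⊗[ℝ] A) | ∀ a : A, q ((1 : ℂ) ⊗ₜ[ℝ] a) ≤ p a},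
      q x ≤ M := by
  induction x with
  | zero => exact ⟨0, fun q _ => (map_zero q.toSeminorm).le⟩
  | tmul z a =>
    refine ⟨‖z‖ * p a, fun q hq => ?_⟩
    have h : z ⊗ₜ[ℝ] a = z • ((1 : ℂ) ⊗ₜ[ℝ] a) := by
      rw [TensorProduct.smul_tmul', smul_eq_mul, mul_one]
    rw [h, map_smul_eq_mul]
    exact mul_le_mul_of_nonneg_left (hq a) (norm_nonneg _)
  | add x y hx hy =>
    obtain ⟨M, hM⟩ := hx
    obtain ⟨N, hN⟩ := hy
    exact ⟨M + N, fun q hq =>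
      (map_add_le_add q.toSeminorm x y).trans (add_le_add (hM q hq) (hN q hq))⟩

/-- `C*(A, p)` has the universal property of the enveloping C*-algebra. -/
theorem isEnvelopingCStar_toEnveloping (p : Seminorm ℝ A) :
    IsEnvelopingCStar.{u, w} p (toEnveloping p) := by
  refine ⟨fun a => ?_, fun B _ β hβ => ?_⟩
  · refine (CStarCompletion.norm_mk _ _).le.trans ?_
    exact CStarSeminorm.sup_le (apply_nonneg _ _) fun q hq => hq a
  -- the complex linear extension of `β`
  let f : ℂ ⊗[ℝ] A →ₗ[ℝ] B := TensorProduct.lift <| LinearMap.mk₂ ℝ (fun z a => z • β a)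
    (fun z z' a => add_smul z z' _) (fun r z a => by rw [smul_assoc])
    (fun z a b => by rw [map_add, smul_add]) (fun r z a => by rw [map_smul, smul_comm])
  have hf : ∀ z a, f (z ⊗ₜ[ℝ] a) = z • β a := fun z a => rfl
  let φ : ℂ ⊗[ℝ] A →⋆ₙₐ[ℂ] B :=
    { toFun := f
      map_smul' := fun z x => by
        induction x with
        | zero => simp
        | add x y hx hy => rw [smul_add, map_add, hx, hy, map_add, smul_add]
        | tmul c a => rw [TensorProduct.smul_tmul', hf, hf, smul_eq_mul, mul_smul]; rfl
      map_zero' := map_zero _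
      map_add' := map_add _
      map_mul' := fun x y => by
        induction x with
        | zero => simp
        | add x x' hx hx' => rw [add_mul, map_add, hx, hx', map_add, add_mul]
        | tmul c a =>
          induction y with
          | zero => simp
          | add x x' hx hx' => rw [mul_add, map_add, hx, hx', map_add, mul_add]
          | tmul d b =>
            rw [Algebra.TensorProduct.tmul_mul_tmul, hf, hf, hf, map_mul, smul_mul_smul_comm]
      map_star' := fun x => by
        induction x with
        | zero => simp
        | add x y hx hy => rw [star_add, map_add, hx, hy, map_add, star_add]
        | tmul c a => rw [TensorProduct.star_tmul, hf, hf, map_star, star_smul] }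
  have hφ : ∀ z a, φ (z ⊗ₜ[ℝ] a) = z • β a := hf
  let qφ : CStarSeminorm (ℂ ⊗[ℝ] A) :=
    { toSeminorm := (normSeminorm ℂ B).comp (φ : ℂ ⊗[ℝ] A →ₗ[ℂ] B)
      mul_le := fun x y => by
        change ‖φ (x * y)‖ ≤ ‖φ x‖ * ‖φ y‖
        rw [map_mul]
        exact norm_mul_le _ _
      star_mul_self := fun x => by
        change ‖φ (star x * x)‖ = ‖φ x‖ ^ 2
        rw [map_mul, map_star, CStarRing.norm_star_mul_self, pow_two] }
  choose M hM using envelopingSeminorm_bound p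
  have hle : ∀ x, ‖φ x‖ ≤ envelopingSeminorm p x := fun x =>
    CStarSeminorm.le_sup (q := qφ) (fun q hq x => hM x q hq) (fun a => by
      change ‖φ ((1 : ℂ) ⊗ₜ[ℝ] a)‖ ≤ p a
      rw [hφ, one_smul]
      exact hβ a) x
  refine ⟨CStarCompletion.lift _ φ hle, fun a => ?_, fun g hg => ?_⟩
  · refine (CStarCompletion.lift_mk _ φ hle _).trans ?_
    rw [hφ, one_smul]
  · refine CStarCompletion.hom_ext fun x => ?_
    rw [CStarCompletion.lift_mk]
    change g (CStarCompletion.mkHom _ x) = φ x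
    induction x with
    | zero => simp
    | add x y hx hy => rw [map_add, map_add, hx, hy, map_add]
    | tmul z a =>
      have h : z ⊗ₜ[ℝ] a = z • ((1 : ℂ) ⊗ₜ[ℝ] a) := by
        rw [TensorProduct.smul_tmul', smul_eq_mul, mul_one]
      rw [h, map_smul, map_smul, map_smul, hφ, one_smul]
      exact congrArg (z • ·) (hg a)

end Enveloping

/-! ### The maximal C*-tensor product -/

section MaxTensor

theorem mul_self_le_of_contraction {C : Type*} [NonUnitalCStarAlgebra C] [PartialOrder C]
    [StarOrderedRing C] (a : C) (ha : ‖a‖ ≤ 1) :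
    (star a * a) * (star a * a) ≤ star a * a := by
  have h := CStarAlgebra.star_left_conjugate_le_norm_smul (a := a) (b := a * star a)
    (.mul_star_self a)
  have h1 : star a * (a * star a) * a = (star a * a) * (star a * a) := by
    simp only [mul_assoc]
  rw [h1] at h
  refine h.trans ?_
  have h2 : ‖a * star a‖ ≤ 1 := by
    rw [CStarRing.norm_self_mul_star]
    exact mul_le_one₀ ha (norm_nonneg _) ha
  calc ‖a * star a‖ • (star a * a) ≤ (1 : ℝ) • (star a * a) :=
        smul_le_smul_of_nonneg_right h2 (star_mul_self_nonneg a)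
    _ = star a * a := one_smul _ _

/-- Every C*-seminorm on the algebraic tensor product of two C*-algebras is bounded by the
projective cross norm on elementary tensors. -/
theorem CStarSeminorm.tmul_le {C₁ C₂ : Type*} [NonUnitalCStarAlgebra C₁]
    [NonUnitalCStarAlgebra C₂] (q : CStarSeminorm (C₁ ⊗[ℂ] C₂)) (x : C₁) (y : C₂) :
    q (x ⊗ₜ[ℂ] y) ≤ ‖x‖ * ‖y‖ := by
  let _ := CStarAlgebra.spectralOrder C₁
  have := CStarAlgebra.spectralOrderedRing C₁
  let _ := CStarAlgebra.spectralOrder C₂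
  have := CStarAlgebra.spectralOrderedRing C₂
  let _ := CStarAlgebra.spectralOrder (CStarCompletion q)
  have := CStarAlgebra.spectralOrderedRing (CStarCompletion q)
  let m := CStarCompletion.mkHom q
  have hm : ∀ z, ‖m z‖ = q z := CStarCompletion.norm_mk q
  -- a nonnegative tensor of nonnegative elements
  have pos : ∀ (a : C₁) (b : C₂), 0 ≤ a → 0 ≤ b → 0 ≤ m (a ⊗ₜ[ℂ] b) := by
    intro a b ha hb
    have h1 := CFC.sqrt_mul_sqrt_self a ha
    have h2 := CFC.sqrt_mul_sqrt_self b hb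
    have s1 : IsSelfAdjoint (CFC.sqrt a) := .of_nonneg (CFC.sqrt_nonneg a)
    have s2 : IsSelfAdjoint (CFC.sqrt b) := .of_nonneg (CFC.sqrt_nonneg b)
    have : m (a ⊗ₜ[ℂ] b) = star (m (CFC.sqrt a ⊗ₜ[ℂ] CFC.sqrt b)) *
        m (CFC.sqrt a ⊗ₜ[ℂ] CFC.sqrt b) := by
      rw [← map_star, TensorProduct.star_tmul, s1.star_eq, s2.star_eq, ← map_mul,
        Algebra.TensorProduct.tmul_mul_tmul, h1, h2]
    rw [this]
    exact star_mul_self_nonneg _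
  have key : ∀ (a : C₁) (b : C₂), ‖a‖ ≤ 1 → ‖b‖ ≤ 1 → q (a ⊗ₜ[ℂ] b) ≤ 1 := by
    intro a b ha hb
    have i1 := mul_self_le_of_contraction a ha
    have i2 := mul_self_le_of_contraction b hb
    set h := star a * a with hh
    set k := star b * b with hk
    have h0 : 0 ≤ h := star_mul_self_nonneg a
    have k0 : 0 ≤ k := star_mul_self_nonneg b
    have hh0 : 0 ≤ h * h := by
      have := star_mul_self_nonneg h
      rwa [(IsSelfAdjoint.of_nonneg h0).star_eq] at this
    have step : m (h ⊗ₜ[ℂ] k) * m (h ⊗ₜ[ℂ] k) ≤ m (h ⊗ₜ[ℂ] k) := by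
      rw [← map_mul, Algebra.TensorProduct.tmul_mul_tmul]
      have e1 := pos (h * h) (k - k * k) hh0 (sub_nonneg.2 i2)
      have e2 := pos (h - h * h) k (sub_nonneg.2 i1) k0
      rw [TensorProduct.tmul_sub, map_sub, sub_nonneg] at e1
      rw [TensorProduct.sub_tmul, map_sub, sub_nonneg] at e2
      exact e1.trans e2
    have s0 := pos h k h0 k0
    have sa : star (m (h ⊗ₜ[ℂ] k)) = m (h ⊗ₜ[ℂ] k) := (IsSelfAdjoint.of_nonneg s0).star_eq
    have n1 : ‖m (h ⊗ₜ[ℂ] k)‖ * ‖m (h ⊗ₜ[ℂ] k)‖ ≤ ‖m (h ⊗ₜ[ℂ] k)‖ := by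
      rw [← CStarRing.norm_star_mul_self, sa]
      refine CStarAlgebra.norm_le_norm_of_nonneg_of_le ?_ step
      have := star_mul_self_nonneg (m (h ⊗ₜ[ℂ] k))
      rwa [sa] at this
    have n2 : ‖m (h ⊗ₜ[ℂ] k)‖ ≤ 1 := by
      by_contra! hlt
      nlinarith
    have n3 : q (h ⊗ₜ[ℂ] k) = q (a ⊗ₜ[ℂ] b) ^ 2 := by
      rw [← q.star_mul_self, TensorProduct.star_tmul, Algebra.TensorProduct.tmul_mul_tmul]
    rw [hm, n3] at n2
    have : 0 ≤ q (a ⊗ₜ[ℂ] b) := apply_nonneg _ _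
    nlinarith
  rcases eq_or_ne x 0 with rfl | hx
  · simp
  rcases eq_or_ne y 0 with rfl | hy
  · simp
  have hx' : 0 < ‖x‖ := norm_pos_iff.2 hx
  have hy' : 0 < ‖y‖ := norm_pos_iff.2 hy
  have hk := key (((‖x‖⁻¹ : ℝ) : ℂ) • x) (((‖y‖⁻¹ : ℝ) : ℂ) • y)
    (by rw [norm_smul]; simp [hx'.ne']) (by rw [norm_smul]; simp [hy'.ne'])
  rw [TensorProduct.tmul_smul, ← TensorProduct.smul_tmul', map_smul_eq_mul, map_smul_eq_mul] at hk
  simp only [Complex.norm_real, norm_inv, norm_norm] at hk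
  field_simp at hk
  linarith

variable (C₁ : Type u₁) (C₂ : Type u₂) [NonUnitalCStarAlgebra C₁] [NonUnitalCStarAlgebra C₂]

/-- The maximal C*-norm on the algebraic tensor product of two C*-algebras: the supremum of
all C*-seminorms (which is finite by `CStarSeminorm.tmul_le`). -/
def maxCStarSeminorm : CStarSeminorm (C₁ ⊗[ℂ] C₂) :=
  CStarSeminorm.sup Set.univ

/-- The maximal (projective) C*-tensor product of two C*-algebras. -/
abbrev MaxTensor : Type (max u₁ u₂) := CStarCompletion (maxCStarSeminorm C₁ C₂)

variable {C₁ C₂}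
variable {A₁ A₂ : Type*}
  [NonUnitalRing A₁] [Module ℝ A₁] [IsScalarTower ℝ A₁ A₁] [SMulCommClass ℝ A₁ A₁]
  [StarRing A₁] [StarModule ℝ A₁]
  [NonUnitalRing A₂] [Module ℝ A₂] [IsScalarTower ℝ A₂ A₂] [SMulCommClass ℝ A₂ A₂]
  [StarRing A₂] [StarModule ℝ A₂]

/-- The linear map underlying `tensorHom`. -/
def tensorLinear (η₁ : A₁ →⋆ₙₐ[ℝ] C₁) (η₂ : A₂ →⋆ₙₐ[ℝ] C₂) : A₁ ⊗[ℝ] A₂ →ₗ[ℝ] MaxTensor C₁ C₂ :=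
  TensorProduct.lift <| LinearMap.mk₂ ℝ
    (fun x y => CStarCompletion.mkHom (maxCStarSeminorm C₁ C₂) (η₁ x ⊗ₜ[ℂ] η₂ y))
    (fun x x' y => by rw [map_add, TensorProduct.add_tmul, map_add])
    (fun r x y => by
      have h : η₁ (r • x) = (r : ℂ) • η₁ x := map_smul η₁ r x
      rw [h, ← TensorProduct.smul_tmul', map_smul]
      rfl)
    (fun x y y' => by rw [map_add, TensorProduct.tmul_add, map_add])
    (fun r x y => by
      have h : η₂ (r • y) = (r : ℂ) • η₂ y := map_smul η₂ r y
      rw [h, TensorProduct.tmul_smul, map_smul]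
      rfl)

theorem tensorLinear_tmul (η₁ : A₁ →⋆ₙₐ[ℝ] C₁) (η₂ : A₂ →⋆ₙₐ[ℝ] C₂) (x : A₁) (y : A₂) :
    tensorLinear η₁ η₂ (x ⊗ₜ[ℝ] y) =
      CStarCompletion.mkHom (maxCStarSeminorm C₁ C₂) (η₁ x ⊗ₜ[ℂ] η₂ y) := rfl

/-- The morphism `η₁ ⊗ η₂ : A₁ ⊗ A₂ → C₁ ⊗ C₂` into the maximal C*-tensor product, with
`(η₁ ⊗ η₂)(x ⊗ y) = η₁ x ⊗ η₂ y`. -/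
def tensorHom (η₁ : A₁ →⋆ₙₐ[ℝ] C₁) (η₂ : A₂ →⋆ₙₐ[ℝ] C₂) : A₁ ⊗[ℝ] A₂ →⋆ₙₐ[ℝ] MaxTensor C₁ C₂ where
  toFun := tensorLinear η₁ η₂
  map_smul' := map_smul (tensorLinear η₁ η₂)
  map_zero' := map_zero _
  map_add' := map_add _
  map_mul' z z' := by
    induction z with
    | zero => simp
    | add z w hz hw => rw [add_mul, map_add, hz, hw, map_add, add_mul]
    | tmul x y =>
      induction z' with
      | zero => simp
      | add z w hz hw => rw [mul_add, map_add, hz, hw, map_add, mul_add]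
      | tmul x' y' =>
        rw [Algebra.TensorProduct.tmul_mul_tmul]
        simp only [tensorLinear_tmul]
        rw [← map_mul, Algebra.TensorProduct.tmul_mul_tmul, map_mul, map_mul]
  map_star' z := by
    induction z with
    | zero => simp
    | add z w hz hw => rw [star_add, map_add, hz, hw, map_add, star_add]
    | tmul x y =>
      rw [TensorProduct.star_tmul]
      simp only [tensorLinear_tmul]
      rw [← map_star, TensorProduct.star_tmul, map_star, map_star]

end MaxTensor

/-! ### Tensor powers -/

section Powers

/-- A real involutive algebra, bundled (used only to define tensor powers by recursion). -/
structure RealStarAlg where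
  carrier : Type u
  [ring : NonUnitalRing carrier]
  [module : Module ℝ carrier]
  [tower : IsScalarTower ℝ carrier carrier]
  [comm : SMulCommClass ℝ carrier carrier]
  [starRing : StarRing carrier]
  [starModule : StarModule ℝ carrier]

attribute [instance] RealStarAlg.ring RealStarAlg.module RealStarAlg.tower RealStarAlg.comm
  RealStarAlg.starRing RealStarAlg.starModule

/-- A C*-algebra, bundled (used only to define tensor powers by recursion). -/
structure BundledCStar where
  carrier : Type u
  [cstar : NonUnitalCStarAlgebra carrier]

attribute [instance] BundledCStar.cstar

variable (A : Type u) [NonUnitalRing A] [Module ℝ A] [IsScalarTower ℝ A A] [SMulCommClass ℝ A A]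
  [StarRing A] [StarModule ℝ A] (C : Type u₁) [NonUnitalCStarAlgebra C]

/-- `powAlg A n` is the `(n + 1)`-fold algebraic tensor power `A ⊗ ⋯ ⊗ A`. -/
def powAlg : ℕ → RealStarAlg.{u}
  | 0 => ⟨A⟩
  | n + 1 => ⟨(powAlg n).carrier ⊗[ℝ] A⟩

/-- `powCStar C n` is the `(n + 1)`-fold maximal C*-tensor power `C ⊗ ⋯ ⊗ C`. -/
def powCStar : ℕ → BundledCStar.{u₁}
  | 0 => ⟨C⟩
  | n + 1 => ⟨MaxTensor (powCStar n).carrier C⟩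

variable {A C}

/-- The `(n + 1)`-fold projective tensor power `p ⊗ ⋯ ⊗ p` of the seminorm `p`. -/
def powSeminorm (p : Seminorm ℝ A) : (n : ℕ) → Seminorm ℝ (powAlg A n).carrier
  | 0 => p
  | n + 1 => projSeminorm (powSeminorm p n) p

/-- The `(n + 1)`-fold tensor power `η ⊗ ⋯ ⊗ η` of the morphism `η`. -/
def powHom (η : A →⋆ₙₐ[ℝ] C) : (n : ℕ) → (powAlg A n).carrier →⋆ₙₐ[ℝ] (powCStar C n).carrier
  | 0 => η
  | n + 1 => tensorHom (powHom η n) η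

end Powers

end EnvCStar

end

noncomputable section

namespace EnvCStar

/-! ### The projective tensor product of involutive seminorms -/

section Projective

variable {A : Type*} {B : Type*} [AddCommGroup A] [Module ℝ A] [AddCommGroup B] [Module ℝ B]

/-! The universal property is reduced to `IsUniversalCompletion`: `η` is contractive, its
complexification has dense range, and `‖complexify η x‖` dominates every C*-seminorm on `ℂ ⊗ A` that
is bounded by `p` on `A`. Unlike the universal property, this condition does not confine the target
algebras to one universe. It holds for `toEnveloping p`, and `IsUniversalCompletion.tensorHom` shows
that tensor products preserve it; the tensor powers follow by induction.

The substance is the maximality of `‖complexify (η₁ ⊗ η₂) x‖`. Let `q` be a C*-seminorm on `ℂ ⊗ (A₁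
⊗ A₂)` bounded by `p₁ ⊗ p₂`, and let `B` be its completion. Without identities there are no elements
`a ⊗ 1` and `1 ⊗ b`, but left multiplication on one factor still lets each `Aᵢ` act on `A₁ ⊗ A₂`. By
`CStarSeminorm.action_le`, `a` acts with `q`-norm at most `pᵢ a`, so it defines a multiplier of `B`
of norm at most `pᵢ a`. Maximality for `ηᵢ` extends this to a morphism `Cᵢ → 𝓜(B)`. The two
morphisms have commuting ranges, hence induce a morphism `ψ` on the maximal tensor product, and `ψ
(η₁ a ⊗ η₂ b)` is left multiplication by `a ⊗ b`. Since `B` embeds isometrically into `𝓜(B)` and `ψ`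
is contractive, `q x ≤ ‖complexify (η₁ ⊗ η₂) x‖`.

That `p₁ ⊗ p₂` takes the value 1 at a nonzero identity rests on two facts: such an identity has the
form `u ⊗ v` with `u`, `v` identities of the factors, and the projective seminorm is multiplicative
on elementary tensors, by Hahn–Banach. -/

theorem projSeminorm_le_of_mem {p : Seminorm ℝ A} {q : Seminorm ℝ B} {z : A ⊗[ℝ] B} {r : ℝ}
    (h : r ∈ reprValues p q z) : projSeminorm p q z ≤ r :=
  csInf_le (reprValues_bddBelow p q z) h

theorem projSeminorm_tmul_le (p : Seminorm ℝ A) (q : Seminorm ℝ B) (x : A) (y : B) :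
    projSeminorm p q (x ⊗ₜ y) ≤ p x * q y :=
  projSeminorm_le_of_mem ⟨[(x, y)], by simp, by simp⟩

/-- A subadditive function with `r (x ⊗ y) ≤ c * (p x * q y)` satisfies `r ≤ c * (p ⊗ q)`. -/
theorem le_mul_projSeminorm {p : Seminorm ℝ A} {q : Seminorm ℝ B} {r : A ⊗[ℝ] B → ℝ} {c : ℝ}
    (hc : 0 ≤ c) (h0 : r 0 = 0) (hadd : ∀ z w, r (z + w) ≤ r z + r w)
    (h : ∀ x y, r (x ⊗ₜ y) ≤ c * (p x * q y)) (z : A ⊗[ℝ] B) : r z ≤ c * projSeminorm p q z := by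
  change r z ≤ c * sInf (reprValues p q z)
  rw [← smul_eq_mul, ← Real.sInf_smul_of_nonneg hc]
  refine le_csInf (reprValues_nonempty p q z).smul_set ?_
  rintro _ ⟨_, ⟨l, rfl, rfl⟩, rfl⟩
  induction l with
  | nil => simp [h0]
  | cons t l ih =>
    simp only [List.map_cons, List.sum_cons, smul_add]
    exact (hadd _ _).trans (add_le_add (h _ _) ih)

/-- Hahn–Banach: on the line through `x ≠ 0`, the functional `c • x ↦ c * p x` is dominated by `p`,
and so is its extension to `A`. -/
theorem exists_dual_of_seminorm (p : Seminorm ℝ A) (x : A) :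
    ∃ f : A →ₗ[ℝ] ℝ, (∀ a, |f a| ≤ p a) ∧ f x = p x := by
  rcases eq_or_ne x 0 with rfl | hx
  · exact ⟨0, fun a => by simp, by simp⟩
  let S := Submodule.span ℝ {x}
  let e := LinearEquiv.toSpanNonzeroSingleton ℝ A x hx
  let f₀ : S →ₗ[ℝ] ℝ := p x • e.symm.toLinearMap
  have hf : ∀ s : S, ‖f₀ s‖ ≤ p s := fun s => by
    obtain ⟨c, rfl⟩ := e.surjective s
    have : ((e c : S) : A) = c • x := by simp [e]
    rw [this, map_smul_eq_mul]
    simp [f₀, abs_of_nonneg (apply_nonneg p x), mul_comm]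
  obtain ⟨g, hg, hle⟩ := Module.Dual.exists_extension_of_le_seminorm S f₀ hf
  refine ⟨g, hle, ?_⟩
  have h1 : e 1 = ⟨x, Submodule.mem_span_singleton_self x⟩ := by ext; simp [e]
  have := hg (e 1)
  rw [h1] at this
  rw [this, ← h1]
  simp [f₀]

/-- The projective seminorm is a cross seminorm. -/
theorem projSeminorm_tmul (p : Seminorm ℝ A) (q : Seminorm ℝ B) (x : A) (y : B) :
    projSeminorm p q (x ⊗ₜ y) = p x * q y := by
  refine le_antisymm (projSeminorm_tmul_le p q x y) ?_
  obtain ⟨f, hf, hfx⟩ := exists_dual_of_seminorm p x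
  obtain ⟨g, hg, hgy⟩ := exists_dual_of_seminorm q y
  -- The functional `f ⊗ g` is bounded by `p ⊗ q` and attains `p x * q y` at `x ⊗ y`, which bounds
  -- every representation of `x ⊗ y` from below.
  let φ : A ⊗[ℝ] B →ₗ[ℝ] ℝ := TensorProduct.lift ((LinearMap.mul ℝ ℝ).compl₁₂ f g)
  have h := le_mul_projSeminorm (p := p) (q := q) (r := fun z => |φ z|) zero_le_one (by simp)
    (fun z w => by rw [map_add]; exact abs_add_le _ _) (fun a b => by
      change |f a * g b| ≤ _
      rw [abs_mul, one_mul]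
      exact mul_le_mul (hf a) (hg b) (abs_nonneg _) (apply_nonneg _ _)) (x ⊗ₜ y)
  rw [one_mul] at h
  refine le_trans ?_ h
  change _ ≤ |f x * g y|
  rw [hfx, hgy]
  exact le_abs_self _

end Projective

section ProjectiveInvolutive

variable {A : Type*} {B : Type*}
  [NonUnitalRing A] [Module ℝ A] [NonUnitalRing B] [Module ℝ B]

/-- `le_mul_projSeminorm` is applied once per factor: in `w`, with `x ⊗ y` fixed and constant `p x *
q y`, then in `z`, with constant `projSeminorm p q w`. -/
theorem projSeminorm_mul_le [IsScalarTower ℝ A A] [SMulCommClass ℝ A A]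
    [IsScalarTower ℝ B B] [SMulCommClass ℝ B B] {p : Seminorm ℝ A} {q : Seminorm ℝ B}
    (hp : ∀ a b, p (a * b) ≤ p a * p b) (hq : ∀ a b, q (a * b) ≤ q a * q b)
    (z w : A ⊗[ℝ] B) : projSeminorm p q (z * w) ≤ projSeminorm p q z * projSeminorm p q w := by
  have h1 : ∀ (x : A) (y : B) (w : A ⊗[ℝ] B),
      projSeminorm p q (x ⊗ₜ y * w) ≤ p x * q y * projSeminorm p q w := fun x y =>
    le_mul_projSeminorm (r := fun w => projSeminorm p q (x ⊗ₜ y * w))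
      (mul_nonneg (apply_nonneg _ _) (apply_nonneg _ _)) (by simp)
      (fun w w' => by rw [mul_add]; exact map_add_le_add _ _ _) (fun a b => by
        rw [Algebra.TensorProduct.tmul_mul_tmul]
        refine (projSeminorm_tmul_le p q _ _).trans ?_
        rw [mul_mul_mul_comm]
        exact mul_le_mul (hp _ _) (hq _ _) (apply_nonneg _ _)
          (mul_nonneg (apply_nonneg _ _) (apply_nonneg _ _)))
  rw [mul_comm]
  exact le_mul_projSeminorm (r := fun z => projSeminorm p q (z * w)) (apply_nonneg _ _) (by simp)
    (fun z z' => by rw [add_mul]; exact map_add_le_add _ _ _)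
    (fun x y => (h1 x y w).trans_eq (mul_comm _ _)) z

variable [StarRing A] [StarModule ℝ A] [StarRing B] [StarModule ℝ B]

theorem projSeminorm_star {p : Seminorm ℝ A} {q : Seminorm ℝ B}
    (hp : ∀ a, p (star a) = p a) (hq : ∀ a, q (star a) = q a)
    (z : A ⊗[ℝ] B) : projSeminorm p q (star z) = projSeminorm p q z := by
  have key : ∀ z, projSeminorm p q (star z) ≤ projSeminorm p q z := fun z => by
    rw [← one_mul (projSeminorm p q z)]
    refine le_mul_projSeminorm (r := fun z => projSeminorm p q (star z)) zero_le_one (by simp)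
      (fun z w => by rw [star_add]; exact map_add_le_add _ _ _) (fun x y => ?_) z
    rw [TensorProduct.star_tmul, one_mul, ← hp x, ← hq y]
    exact projSeminorm_tmul_le p q _ _
  refine le_antisymm (key z) ?_
  simpa using key (star z)

end ProjectiveInvolutive

/-! ### Identities in a tensor product of algebras. -/

section Identity

variable {A : Type*} {B : Type*}
  [NonUnitalRing A] [Module ℝ A] [IsScalarTower ℝ A A] [SMulCommClass ℝ A A]
  [NonUnitalRing B] [Module ℝ B] [IsScalarTower ℝ B B] [SMulCommClass ℝ B B]

/-- If `A ⊗ B` has an identity and `B` is nontrivial, then `A` has an identity. -/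
theorem exists_identity_left_of_tensor {e : A ⊗[ℝ] B} (he : ∀ z, e * z = z ∧ z * e = z)
    {b : B} (hb : b ≠ 0) : ∃ u : A, ∀ a, u * a = a ∧ a * u = a := by
  -- A functional with `φ b ≠ 0` gives the slice map `a ⊗ c ↦ φ c • a`. Slicing `e * (a ⊗ b) = a ⊗
  -- b` and `(a ⊗ b) * e = a ⊗ b`, then dividing by `φ b`, produces a left and a right identity of
  -- `A`.
  obtain ⟨φ, hφ⟩ := Module.Projective.exists_dual_ne_zero ℝ hb
  let Φ : A ⊗[ℝ] B →ₗ[ℝ] A := TensorProduct.lift ((LinearMap.lsmul ℝ A).flip.compl₂ φ)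
  have hΦ : ∀ a c, Φ (a ⊗ₜ c) = φ c • a := fun a c => rfl
  let Sl : A ⊗[ℝ] B →ₗ[ℝ] A := Φ ∘ₗ (LinearMap.mulRight ℝ b).lTensor A
  let Sr : A ⊗[ℝ] B →ₗ[ℝ] A := Φ ∘ₗ (LinearMap.mulLeft ℝ b).lTensor A
  have hl : ∀ a z, Sl z * a = Φ (z * a ⊗ₜ b) := fun a z => by
    induction z with
    | zero => simp
    | add z w hz hw => rw [map_add, add_mul, hz, hw, add_mul, map_add]
    | tmul x y =>
      rw [Algebra.TensorProduct.tmul_mul_tmul, hΦ]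
      change (φ (y * b) • x) * a = _
      rw [smul_mul_assoc]
  have hr : ∀ a z, a * Sr z = Φ (a ⊗ₜ b * z) := fun a z => by
    induction z with
    | zero => simp
    | add z w hz hw => rw [map_add, mul_add, hz, hw, mul_add, map_add]
    | tmul x y =>
      rw [Algebra.TensorProduct.tmul_mul_tmul, hΦ]
      change a * (φ (b * y) • x) = _
      rw [mul_smul_comm]
  have el : ∀ a, ((φ b)⁻¹ • Sl e) * a = a := fun a => by
    rw [smul_mul_assoc, hl, (he _).1, hΦ, inv_smul_smul₀ hφ]
  have er : ∀ a, a * ((φ b)⁻¹ • Sr e) = a := fun a => by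
    rw [mul_smul_comm, hr, (he _).2, hΦ, inv_smul_smul₀ hφ]
  -- A left identity and a right identity always coincide.
  have h : (φ b)⁻¹ • Sl e = (φ b)⁻¹ • Sr e := (er _).symm.trans (el _)
  exact ⟨_, fun a => ⟨el a, h ▸ er a⟩⟩

/-- As `e ≠ 0`, some elementary tensor is nonzero, so both factors have nonzero elements to slice
with; the flip `A ⊗ B ≃ B ⊗ A` handles the second factor. Then `u ⊗ v` is a left identity and `e` a
right one, so they are equal. -/
theorem exists_identity_of_tensor {e : A ⊗[ℝ] B} (he : ∀ z, e * z = z ∧ z * e = z) (h0 : e ≠ 0) :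
    ∃ (u : A) (v : B), (∀ a, u * a = a ∧ a * u = a) ∧ (∀ b, v * b = b ∧ b * v = b) ∧
      e = u ⊗ₜ v := by
  obtain ⟨a₀, b₀, hab⟩ : ∃ (a : A) (b : B), a ⊗ₜ[ℝ] b ≠ 0 := by
    by_contra! h
    have : ∀ z : A ⊗[ℝ] B, z = 0 := fun z => by
      induction z with
      | zero => rfl
      | tmul x y => exact h x y
      | add x y hx hy => rw [hx, hy, add_zero]
    exact h0 (this e)
  have ha : a₀ ≠ 0 := fun h => hab (by rw [h, TensorProduct.zero_tmul])
  have hb : b₀ ≠ 0 := fun h => hab (by rw [h, TensorProduct.tmul_zero])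
  let σ := TensorProduct.comm ℝ A B
  have hσ : ∀ z w, σ (z * w) = σ z * σ w := fun z w => by
    induction z with
    | zero => simp
    | add z z' hz hz' => rw [add_mul, map_add, hz, hz', map_add, add_mul]
    | tmul x y =>
      induction w with
      | zero => simp
      | add z z' hz hz' => rw [mul_add, map_add, hz, hz', map_add, mul_add]
      | tmul x' y' => simp [σ, Algebra.TensorProduct.tmul_mul_tmul]
  have he' : ∀ z, σ e * z = z ∧ z * σ e = z := fun z => by
    obtain ⟨z, rfl⟩ := σ.surjective z
    rw [← hσ, ← hσ, (he z).1, (he z).2]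
    exact ⟨rfl, rfl⟩
  obtain ⟨u, hu⟩ := exists_identity_left_of_tensor he hb
  obtain ⟨v, hv⟩ := exists_identity_left_of_tensor he' ha
  refine ⟨u, v, hu, hv, ?_⟩
  have huv : ∀ z : A ⊗[ℝ] B, u ⊗ₜ v * z = z := fun z => by
    induction z with
    | zero => simp
    | add z w hz hw => rw [mul_add, hz, hw]
    | tmul x y => rw [Algebra.TensorProduct.tmul_mul_tmul, (hu x).1, (hv y).1]
  exact (huv e).symm.trans (he _).2

end Identity

theorem IsInvolutiveSeminorm.projSeminorm
    {A : Type*} {B : Type*}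
    [NonUnitalRing A] [Module ℝ A] [IsScalarTower ℝ A A] [SMulCommClass ℝ A A]
    [NonUnitalRing B] [Module ℝ B] [IsScalarTower ℝ B B] [SMulCommClass ℝ B B]
    [StarRing A] [StarModule ℝ A] [StarRing B] [StarModule ℝ B]
    {p : Seminorm ℝ A} {q : Seminorm ℝ B} (hp : IsInvolutiveSeminorm p)
    (hq : IsInvolutiveSeminorm q) : IsInvolutiveSeminorm (EnvCStar.projSeminorm p q) where
  mul_le := projSeminorm_mul_le hp.mul_le hq.mul_le
  star_eq := projSeminorm_star hp.star_eq hq.star_eq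
  identity_eq_one e h0 he := by
    obtain ⟨u, v, hu, hv, rfl⟩ := exists_identity_of_tensor he h0
    have hu0 : u ≠ 0 := fun h => h0 (by rw [h, TensorProduct.zero_tmul])
    have hv0 : v ≠ 0 := fun h => h0 (by rw [h, TensorProduct.tmul_zero])
    rw [projSeminorm_tmul, hp.identity_eq_one u hu0 hu, hq.identity_eq_one v hv0 hv, one_mul]

/-! ### A criterion for enveloping C*-algebras -/

section Criterion

variable {A : Type u} [NonUnitalRing A] [Module ℝ A] [IsScalarTower ℝ A A] [SMulCommClass ℝ A A]
  [StarRing A] [StarModule ℝ A] {C : Type*} [NonUnitalCStarAlgebra C]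
  {D : Type*} [NonUnitalRing D] [Module ℂ D] [StarRing D]

/-- The complex linear extension `ℂ ⊗ A → C` of a morphism `A → C` of real involutive algebras. -/
def complexify (β : A →⋆ₙₐ[ℝ] C) : ℂ ⊗[ℝ] A →⋆ₙₐ[ℂ] C :=
  let f : ℂ ⊗[ℝ] A →ₗ[ℝ] C := TensorProduct.lift <| LinearMap.mk₂ ℝ (fun z a => z • β a)
    (fun z z' a => add_smul z z' _) (fun r z a => by rw [smul_assoc])
    (fun z a b => by rw [map_add, smul_add]) (fun r z a => by rw [map_smul, smul_comm])
  have hf : ∀ z a, f (z ⊗ₜ[ℝ] a) = z • β a := fun z a => rfl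
  { toFun := f
    map_smul' := fun z x => by
      induction x with
      | zero => simp
      | add x y hx hy => rw [smul_add, map_add, hx, hy, map_add, smul_add]
      | tmul c a => rw [TensorProduct.smul_tmul', hf, hf, smul_eq_mul, mul_smul]; rfl
    map_zero' := map_zero _
    map_add' := map_add _
    map_mul' := fun x y => by
      induction x with
      | zero => simp
      | add x x' hx hx' => rw [add_mul, map_add, hx, hx', map_add, add_mul]
      | tmul c a =>
        induction y with
        | zero => simp
        | add x x' hx hx' => rw [mul_add, map_add, hx, hx', map_add, mul_add]
        | tmul d b =>
          rw [Algebra.TensorProduct.tmul_mul_tmul, hf, hf, hf, map_mul, smul_mul_smul_comm]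
    map_star' := fun x => by
      induction x with
      | zero => simp
      | add x y hx hy => rw [star_add, map_add, hx, hy, map_add, star_add]
      | tmul c a => rw [TensorProduct.star_tmul, hf, hf, map_star, star_smul] }

theorem complexify_tmul (β : A →⋆ₙₐ[ℝ] C) (z : ℂ) (a : A) :
    complexify β (z ⊗ₜ a) = z • β a := rfl

theorem tmul_eq_smul_one_tmul {A : Type*} [AddCommGroup A] [Module ℝ A] (z : ℂ) (a : A) :
    z ⊗ₜ[ℝ] a = z • ((1 : ℂ) ⊗ₜ[ℝ] a) := by
  rw [TensorProduct.smul_tmul', smul_eq_mul, mul_one]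

theorem eq_complexify {β : A →⋆ₙₐ[ℝ] C} {F : Type*} [FunLike F (ℂ ⊗[ℝ] A) C]
    [LinearMapClass F ℂ (ℂ ⊗[ℝ] A) C] {φ : F} (h : ∀ a, φ (1 ⊗ₜ a) = β a)
    (x : ℂ ⊗[ℝ] A) : φ x = complexify β x := by
  induction x with
  | zero => simp
  | add x y hx hy => rw [map_add, map_add, hx, hy]
  | tmul z a => rw [complexify_tmul, tmul_eq_smul_one_tmul, map_smul, h]

/-- The C*-seminorm `x ↦ ‖φ x‖` induced by a morphism into a C*-algebra. -/
def CStarSeminorm.ofHom (φ : D →⋆ₙₐ[ℂ] C) : CStarSeminorm D where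
  toSeminorm := (normSeminorm ℂ C).comp (φ : D →ₗ[ℂ] C)
  mul_le x y := by
    change ‖φ (x * y)‖ ≤ ‖φ x‖ * ‖φ y‖
    rw [map_mul]
    exact norm_mul_le _ _
  star_mul_self x := by
    change ‖φ (star x * x)‖ = ‖φ x‖ ^ 2
    rw [map_mul, map_star, CStarRing.norm_star_mul_self, pow_two]

theorem CStarSeminorm.ofHom_apply (φ : D →⋆ₙₐ[ℂ] C) (x : D) :
    CStarSeminorm.ofHom φ x = ‖φ x‖ := rfl

theorem continuous_of_cstar {B : Type*} [NonUnitalCStarAlgebra B] (f : C →⋆ₙₐ[ℂ] B) :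
    Continuous f :=
  AddMonoidHomClass.continuous_of_bound f 1 fun x => by
    simpa using NonUnitalStarAlgHom.norm_apply_le f x

/-- A morphism of `D` into a C*-algebra which is dominated by a morphism `ι` of dense range
factors through `ι`. -/
theorem exists_extension_of_denseRange [IsScalarTower ℂ D D] [SMulCommClass ℂ D D]
    [StarModule ℂ D] {B : Type*} [NonUnitalCStarAlgebra B] {ι : D →⋆ₙₐ[ℂ] C}
    (hι : DenseRange ι) (φ : D →⋆ₙₐ[ℂ] B) (h : ∀ x, ‖φ x‖ ≤ ‖ι x‖) :
    ∃ f : C →⋆ₙₐ[ℂ] B, ∀ x, f (ι x) = φ x := by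
  -- Completing `D` for `‖ι x‖` recovers `C`: the induced `j` is isometric with dense range. The
  -- completion carries the extension of `φ`, which is transported back along `j`.
  let q := CStarSeminorm.ofHom ι
  let j : CStarCompletion q →⋆ₙₐ[ℂ] C := CStarCompletion.lift q ι fun x => le_rfl
  have hj : ∀ x, j (CStarCompletion.mk q x) = ι x := CStarCompletion.lift_mk q ι _
  have hjc : Continuous j := continuous_of_cstar j
  have hn : ∀ y, ‖j y‖ = ‖y‖ := CStarCompletion.induction q
    (isClosed_eq hjc.norm continuous_norm) fun x => by
      rw [hj, CStarCompletion.norm_mk]; rfl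
  have hiso : Isometry j := AddMonoidHomClass.isometry_of_norm j hn
  -- The isometric image of a complete space is closed, and this one contains the dense range of
  -- `ι`.
  have hsurj : Function.Surjective j := by
    rw [← Set.range_eq_univ, ← hiso.isClosedEmbedding.isClosed_range.closure_eq]
    refine (hι.mono ?_).closure_eq
    rintro _ ⟨x, rfl⟩
    exact ⟨_, hj x⟩
  let e := StarAlgEquiv.ofBijective j ⟨hiso.injective, hsurj⟩
  have he : ∀ x, e.symm (ι x) = CStarCompletion.mk q x := fun x =>
    e.injective ((e.apply_symm_apply _).trans (hj x).symm)
  refine ⟨(CStarCompletion.lift q φ h).comp (e.symm : C →⋆ₙₐ[ℂ] CStarCompletion q), fun x => ?_⟩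
  change CStarCompletion.lift q φ h (e.symm (ι x)) = φ x
  rw [he]
  exact CStarCompletion.lift_mk q φ h x

/-- `η : A → C` is contractive, its complexification has dense range and induces the largest
C*-seminorm on `ℂ ⊗ A` which is bounded by `p` on `A`. -/
structure IsUniversalCompletion (p : Seminorm ℝ A) (η : A →⋆ₙₐ[ℝ] C) : Prop where
  norm_le : ∀ a, ‖η a‖ ≤ p a
  denseRange : DenseRange (complexify η)
  le_norm : ∀ q : CStarSeminorm (ℂ ⊗[ℝ] A), (∀ a, q ((1 : ℂ) ⊗ₜ a) ≤ p a) →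
    ∀ x, q x ≤ ‖complexify η x‖

/-- For a contractive `β`, the seminorm `‖complexify β x‖` is one of those dominated in `le_norm`,
so `complexify β` factors through `complexify η`. Uniqueness holds because morphisms of C*-algebras
are continuous and the range is dense. -/
theorem IsUniversalCompletion.isEnvelopingCStar {p : Seminorm ℝ A} {η : A →⋆ₙₐ[ℝ] C}
    (h : IsUniversalCompletion p η) : IsEnvelopingCStar.{u, w} p η := by
  refine ⟨h.norm_le, fun B _ β hβ => ?_⟩
  obtain ⟨f, hf⟩ := exists_extension_of_denseRange h.denseRange (complexify β)
    (h.le_norm (.ofHom (complexify β)) fun a => by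
      rw [CStarSeminorm.ofHom_apply, complexify_tmul, one_smul]
      exact hβ a)
  have hf1 : ∀ a, f (η a) = β a := fun a => by
    have := hf (1 ⊗ₜ a)
    rwa [complexify_tmul, complexify_tmul, one_smul, one_smul] at this
  refine ⟨f, hf1, fun g hg => ?_⟩
  refine DFunLike.coe_injective (h.denseRange.equalizer (continuous_of_cstar g)
    (continuous_of_cstar f) (funext fun x => ?_))
  rw [Function.comp_apply, Function.comp_apply, hf]
  refine eq_complexify (φ := g.comp (complexify η)) (fun a => ?_) x
  change g (complexify η (1 ⊗ₜ a)) = _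
  rw [complexify_tmul, one_smul, hg]

/-- The complexification of `toEnveloping p` is the canonical map into the completion for
`envelopingSeminorm p`, so both density and maximality are built into the construction. -/
theorem isUniversalCompletion_toEnveloping (p : Seminorm ℝ A) :
    IsUniversalCompletion p (toEnveloping p) := by
  have hc : ∀ x, CStarCompletion.mkHom (envelopingSeminorm p) x = complexify (toEnveloping p) x :=
    eq_complexify fun a => rfl
  refine ⟨(isEnvelopingCStar_toEnveloping.{u, u} p).1, ?_, fun q hq x => ?_⟩
  · have : ⇑(complexify (toEnveloping p)) = CStarCompletion.mk (envelopingSeminorm p) :=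
      funext fun x => (hc x).symm
    rw [this]
    exact CStarCompletion.denseRange_mk _
  · rw [← hc]
    refine le_of_le_of_eq ?_ (CStarCompletion.norm_mk (envelopingSeminorm p) x).symm
    choose M hM using envelopingSeminorm_bound p
    exact CStarSeminorm.le_sup (fun q hq x => hM x q hq) hq x

/-- `ℂ` is the enveloping C*-algebra of `(ℝ, |·|)`. -/
theorem isUniversalCompletion_real : IsUniversalCompletion (normSeminorm ℝ ℝ)
    ((StarAlgHom.ofId ℝ ℂ : ℝ →⋆ₐ[ℝ] ℂ) : ℝ →⋆ₙₐ[ℝ] ℂ) := by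
  set η : ℝ →⋆ₙₐ[ℝ] ℂ := ((StarAlgHom.ofId ℝ ℂ : ℝ →⋆ₐ[ℝ] ℂ) : ℝ →⋆ₙₐ[ℝ] ℂ)
  have h : ∀ r : ℝ, η r = (r : ℂ) := fun r => rfl
  refine ⟨fun r => by rw [h, Complex.norm_real]; rfl, ?_, fun q hq x => ?_⟩
  · refine Function.Surjective.denseRange fun z => ⟨z ⊗ₜ 1, ?_⟩
    rw [complexify_tmul, h]; simp
  -- Every element of `ℂ ⊗ ℝ` is `z ⊗ 1`, and `q (z ⊗ 1) = ‖z‖ * q (1 ⊗ 1) ≤ ‖z‖`.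
  · obtain ⟨z, rfl⟩ := (TensorProduct.rid ℝ ℂ).symm.surjective x
    rw [TensorProduct.rid_symm_apply, complexify_tmul, h, tmul_eq_smul_one_tmul, map_smul_eq_mul,
      norm_smul]
    refine mul_le_mul_of_nonneg_left ((hq 1).trans ?_) (norm_nonneg _)
    simp

end Criterion

/-! ### Multipliers of completions -/

open scoped MultiplierAlgebra

/-- `l` is an action of the involutive algebra `E` on the involutive algebra `D` by left
multipliers, with `l (a*)` adjoint to `l a`. -/
structure IsStarAction {𝕜 E D : Type*} [CommSemiring 𝕜] [NonUnitalRing E] [Module 𝕜 E] [StarRing E]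
    [NonUnitalRing D] [Module 𝕜 D] [StarRing D] (l : E →ₗ[𝕜] D →ₗ[𝕜] D) : Prop where
  mul_apply : ∀ a b x, l (a * b) x = l a (l b x)
  adjoint : ∀ a x y, star (l a x) * y = star x * l (star a) y

/-! ### Automatic contractivity of star actions. -/

section Bound

variable {D : Type*} [NonUnitalRing D] [Module ℂ D] [StarRing D]

/-- An action which is `p`-bounded with a constant depending on the vector is `p`-bounded with
respect to every C*-seminorm. -/
theorem CStarSeminorm.action_le (q : CStarSeminorm D) {A : Type*} [NonUnitalRing A] [Module ℝ A]
    [StarRing A] {p : Seminorm ℝ A} (hp : IsInvolutiveSeminorm p) {ρ : A → D → D}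
    (hmul : ∀ a b x, ρ (a * b) x = ρ a (ρ b x))
    (hstar : ∀ a x y, star (ρ a x) * y = star x * ρ (star a) y) {x : D}
    (hC : ∃ C, ∀ a, q (ρ a x) ≤ C * p a) (a : A) : q (ρ a x) ≤ p a * q x := by
  -- A Cauchy–Schwarz inequality: by the C*-identity and adjointness the left side is `q (x* ρ(a*a)
  -- x)`.
  have hsq : ∀ a, q (ρ a x) ^ 2 ≤ q x * q (ρ (star a * a) x) := fun a => by
    rw [← q.star_mul_self, hstar, ← hmul, ← q.star_eq x]
    exact q.mul_le _ _
  -- The constants admissible for the fixed vector `x`. This set is closed, so there is a least one,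
  -- `K`, and the claim becomes `K ≤ q x`.
  let S : Set ℝ := {C | 0 ≤ C ∧ ∀ a, q (ρ a x) ≤ C * p a}
  have hne : S.Nonempty := by
    obtain ⟨C, hC⟩ := hC
    exact ⟨|C|, abs_nonneg _, fun a =>
      (hC a).trans (mul_le_mul_of_nonneg_right (le_abs_self _) (apply_nonneg _ _))⟩
  have hbdd : BddBelow S := ⟨0, fun C hC => hC.1⟩
  have hclosed : IsClosed S := by
    have : S = Set.Ici 0 ∩ ⋂ a, {C | q (ρ a x) ≤ C * p a} := by
      ext C; simp [S]
    rw [this]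
    exact isClosed_Ici.inter (isClosed_iInter fun a => isClosed_le (by fun_prop) (by fun_prop))
  obtain ⟨hK0, hK⟩ : sInf S ∈ S := hclosed.csInf_mem hne hbdd
  set K := sInf S
  have hx : 0 ≤ q x := apply_nonneg _ _
  -- Inserting the bound with `K` into `hsq` makes `√(q x * K)` admissible too. Minimality then
  -- gives `K ^ 2 ≤ q x * K`, which forces `K ≤ q x`.
  have hmem : √(q x * K) ∈ S := by
    refine ⟨Real.sqrt_nonneg _, fun a => ?_⟩
    have h1 : q (ρ a x) ^ 2 ≤ (q x * K) * p a ^ 2 := by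
      refine (hsq a).trans ?_
      have h2 : p (star a * a) ≤ p a ^ 2 := by
        have := hp.mul_le (star a) a
        rwa [hp.star_eq, ← pow_two] at this
      rw [mul_assoc]
      exact mul_le_mul_of_nonneg_left
        ((hK _).trans (mul_le_mul_of_nonneg_left h2 hK0)) hx
    refine (Real.le_sqrt_of_sq_le h1).trans_eq ?_
    rw [Real.sqrt_mul (mul_nonneg hx hK0), Real.sqrt_sq (apply_nonneg _ _)]
  have hle : K ≤ √(q x * K) := csInf_le hbdd hmem
  have hKx : K ≤ q x := by
    by_contra! h
    have := (Real.le_sqrt hK0 (mul_nonneg hx hK0)).1 hle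
    nlinarith
  exact (hK a).trans ((mul_le_mul_of_nonneg_right hKx (apply_nonneg _ _)).trans_eq (mul_comm _ _))

end Bound

section Multiplier

variable {E D : Type*} [NonUnitalRing E] [Module ℂ E] [StarRing E]
  [NonUnitalRing D] [Module ℂ D] [StarRing D] (q : CStarSeminorm D)

namespace CStarCompletion

/-- The canonical map into the completion, as a linear map. -/
def mkLinear : D →ₗ[ℂ] CStarCompletion q where
  toFun := mk q
  map_add' := mk_add q
  map_smul' := mk_smul q

/-- The continuous extension of a `q`-bounded linear map to the completion. -/
def mapL (l : D →ₗ[ℂ] D) : CStarCompletion q →L[ℂ] CStarCompletion q :=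
  (mkLinear q ∘ₗ l).extendOfNorm (mkLinear q)

variable {q}

theorem mapL_mk {l : D →ₗ[ℂ] D} (h : ∃ C, ∀ x, q (l x) ≤ C * q x) (x : D) :
    mapL q l (mk q x) = mk q (l x) :=
  LinearMap.extendOfNorm_eq (f := mkLinear q ∘ₗ l) (e := mkLinear q) (denseRange_mk q)
    (by
      obtain ⟨C, hC⟩ := h
      refine ⟨C, fun x => ?_⟩
      change ‖mk q (l x)‖ ≤ C * ‖mk q x‖
      rw [norm_mk, norm_mk]
      exact hC x) x

theorem norm_mapL_le {l : D →ₗ[ℂ] D} {C : ℝ} (hC : 0 ≤ C) (h : ∀ x, q (l x) ≤ C * q x) :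
    ‖mapL q l‖ ≤ C :=
  LinearMap.opNorm_extendOfNorm_le (f := mkLinear q ∘ₗ l) (e := mkLinear q) (denseRange_mk q) hC
    fun x => by
      change ‖mk q (l x)‖ ≤ C * ‖mk q x‖
      rw [norm_mk, norm_mk]
      exact h x

variable [IsScalarTower ℂ D D] [SMulCommClass ℂ D D] [StarModule ℂ D]

/-- The norm of a multiplier is the norm of its left component, so that component determines it; by
continuity, its values on the dense image of `D` suffice. -/
theorem multiplier_ext {m n : 𝓜(ℂ, CStarCompletion q)}
    (h : ∀ x, m.fst (mk q x) = n.fst (mk q x)) : m = n := by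
  rw [← sub_eq_zero, ← norm_eq_zero, ← DoubleCentralizer.norm_fst, DoubleCentralizer.sub_fst,
    norm_eq_zero, sub_eq_zero]
  exact DFunLike.ext _ _ (induction q (isClosed_eq m.fst.continuous n.fst.continuous) h)

end CStarCompletion

open CStarCompletion

variable [IsScalarTower ℂ D D] [SMulCommClass ℂ D D] [StarModule ℂ D]
  {q} {l : E →ₗ[ℂ] D →ₗ[ℂ] D}

/-- The multiplier of the completion induced by a `q`-bounded left multiplier of `D`. -/
def IsStarAction.multiplier (hl : IsStarAction l) (hb : ∀ e, ∃ C, ∀ x, q (l e x) ≤ C * q x)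
    (e : E) : 𝓜(ℂ, CStarCompletion q) where
  fst := mapL q (l e)
  -- The right component is `x ↦ (l(e*) x*)*`; adjointness of `l` on `D` is then exactly the
  -- centrality condition on a dense set.
  snd := (((starₗᵢ ℂ : CStarCompletion q ≃ₗᵢ⋆[ℂ] _) : CStarCompletion q →L⋆[ℂ] _).comp
    (mapL q (l (star e)))).comp
      ((starₗᵢ ℂ : CStarCompletion q ≃ₗᵢ⋆[ℂ] _) : CStarCompletion q →L⋆[ℂ] _)
  central := by
    have key : ∀ x y : CStarCompletion q,
        star (mapL q (l (star e)) (star x)) * y = x * mapL q (l e) y :=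
      induction₂ q (isClosed_eq (by fun_prop) (by fun_prop)) fun x y => by
        rw [← mk_star, mapL_mk (hb _), mapL_mk (hb _), ← mk_star, ← mk_mul, ← mk_mul,
          hl.adjoint, star_star, star_star]
    exact key

theorem IsStarAction.multiplier_fst_mk (hl : IsStarAction l)
    (hb : ∀ e, ∃ C, ∀ x, q (l e x) ≤ C * q x) (e : E) (x : D) :
    (hl.multiplier hb e).fst (CStarCompletion.mk q x) = CStarCompletion.mk q (l e x) :=
  mapL_mk (hb e) x

/-- A `q`-bounded action of `E` on `D` induces a morphism from `E` to the multiplier algebra of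
the completion of `D`. -/
def IsStarAction.multiplierHom (hl : IsStarAction l)
    (hb : ∀ e, ∃ C, ∀ x, q (l e x) ≤ C * q x) : E →⋆ₙₐ[ℂ] 𝓜(ℂ, CStarCompletion q) where
  toFun := hl.multiplier hb
  map_smul' c e := multiplier_ext fun x => by
    rw [hl.multiplier_fst_mk, map_smul, LinearMap.smul_apply, mk_smul, ← hl.multiplier_fst_mk hb]
    rfl
  map_zero' := multiplier_ext fun x => by
    rw [hl.multiplier_fst_mk, map_zero, LinearMap.zero_apply, mk_zero]
    rfl
  map_add' e f := multiplier_ext fun x => by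
    rw [hl.multiplier_fst_mk, map_add, LinearMap.add_apply, mk_add, ← hl.multiplier_fst_mk hb,
      ← hl.multiplier_fst_mk hb]
    rfl
  map_mul' e f := multiplier_ext fun x => by
    rw [hl.multiplier_fst_mk, hl.mul_apply, ← hl.multiplier_fst_mk hb, ← hl.multiplier_fst_mk hb]
    rfl
  map_star' e := multiplier_ext fun x => by
    rw [hl.multiplier_fst_mk, DoubleCentralizer.star_fst]
    change _ = star (star (mapL q (l (star e)) (star (star (CStarCompletion.mk q x)))))
    rw [star_star, star_star, mapL_mk (hb _)]

theorem IsStarAction.multiplierHom_fst_mk (hl : IsStarAction l)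
    (hb : ∀ e, ∃ C, ∀ x, q (l e x) ≤ C * q x) (e : E) (x : D) :
    (hl.multiplierHom hb e).fst (CStarCompletion.mk q x) = CStarCompletion.mk q (l e x) :=
  mapL_mk (hb e) x

theorem IsStarAction.norm_multiplierHom_le (hl : IsStarAction l)
    (hb : ∀ e, ∃ C, ∀ x, q (l e x) ≤ C * q x) {e : E} {C : ℝ} (hC : 0 ≤ C)
    (h : ∀ x, q (l e x) ≤ C * q x) : ‖hl.multiplierHom hb e‖ ≤ C := by
  rw [← DoubleCentralizer.norm_fst]
  exact norm_mapL_le hC h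

end Multiplier

/-! ### Actions on the complexification and their extension to multipliers. -/

section Complexify

variable {A T : Type*} [NonUnitalRing A] [Module ℝ A] [NonUnitalRing T] [Module ℝ T]

/-- The complexification of an action. -/
def complexifyAction (L : A →ₗ[ℝ] T →ₗ[ℝ] T) : ℂ ⊗[ℝ] A →ₗ[ℂ] ℂ ⊗[ℝ] T →ₗ[ℂ] ℂ ⊗[ℝ] T :=
  LinearMap.tensorProduct ℝ ℂ T T ∘ₗ L.baseChange ℂ

theorem complexifyAction_tmul (L : A →ₗ[ℝ] T →ₗ[ℝ] T) (z w : ℂ) (a : A) (t : T) :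
    complexifyAction L (z ⊗ₜ a) (w ⊗ₜ t) = (z * w) ⊗ₜ L a t := rfl

variable [StarRing A] [IsScalarTower ℝ A A] [SMulCommClass ℝ A A] [StarModule ℝ A]
  [StarRing T] [IsScalarTower ℝ T T] [SMulCommClass ℝ T T] [StarModule ℝ T]

theorem IsStarAction.complexifyAction {L : A →ₗ[ℝ] T →ₗ[ℝ] T} (hL : IsStarAction L) :
    IsStarAction (complexifyAction L) where
  mul_apply e f x := by
    induction e with
    | zero => simp
    | add a b ha hb =>
      rw [add_mul, map_add, map_add, LinearMap.add_apply, LinearMap.add_apply, ha, hb]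
    | tmul z a =>
      induction f with
      | zero => simp
      | add b c hb hc =>
        rw [mul_add, map_add, map_add, LinearMap.add_apply, LinearMap.add_apply, hb, hc, map_add]
      | tmul w b =>
        induction x with
        | zero => simp
        | add x y hx hy => rw [map_add, hx, hy, map_add, map_add]
        | tmul v t =>
          rw [Algebra.TensorProduct.tmul_mul_tmul, complexifyAction_tmul, complexifyAction_tmul,
            complexifyAction_tmul, hL.mul_apply, mul_assoc]
  adjoint e x y := by
    induction e with
    | zero => simp
    | add a b ha hb =>
      rw [map_add, LinearMap.add_apply, star_add, add_mul, ha, hb, star_add, map_add,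
        LinearMap.add_apply, mul_add]
    | tmul z a =>
      induction x with
      | zero => simp
      | add b c hb hc => rw [map_add, star_add, star_add, add_mul, add_mul, hb, hc]
      | tmul w s =>
        induction y with
        | zero => simp
        | add x y hx hy => rw [mul_add, map_add, mul_add, hx, hy]
        | tmul v t =>
          simp only [complexifyAction_tmul, TensorProduct.star_tmul,
            Algebra.TensorProduct.tmul_mul_tmul, hL.adjoint]
          rw [star_mul, mul_assoc]

variable {L : A →ₗ[ℝ] T →ₗ[ℝ] T} {p : Seminorm ℝ A} {P : Seminorm ℝ T}
  {q : CStarSeminorm (ℂ ⊗[ℝ] T)}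

/-- On `∑ zᵢ ⊗ tᵢ` the bounds on `q` and `P` only give the vector-dependent constant `∑ ‖zᵢ‖ * P
tᵢ`; `CStarSeminorm.action_le` improves it to `q x`. -/
theorem complexifyAction_le (hL : IsStarAction L) (hp : IsInvolutiveSeminorm p)
    (hP : ∀ a t, P (L a t) ≤ p a * P t) (hq : ∀ t, q ((1 : ℂ) ⊗ₜ t) ≤ P t) (a : A)
    (x : ℂ ⊗[ℝ] T) : q (complexifyAction L (1 ⊗ₜ a) x) ≤ p a * q x := by
  refine q.action_le hp (ρ := fun a => complexifyAction L (1 ⊗ₜ a)) (fun a b x => ?_)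
    (fun a x y => ?_) ?_ a
  · rw [← hL.complexifyAction.mul_apply, Algebra.TensorProduct.tmul_mul_tmul, one_mul]
  · rw [hL.complexifyAction.adjoint, TensorProduct.star_tmul, star_one]
  · induction x with
    | zero => exact ⟨0, fun a => by simp⟩
    | add x y hx hy =>
      obtain ⟨C, hC⟩ := hx
      obtain ⟨C', hC'⟩ := hy
      refine ⟨C + C', fun a => ?_⟩
      rw [map_add, add_mul]
      exact (map_add_le_add q.toSeminorm _ _).trans (add_le_add (hC a) (hC' a))
    | tmul z t =>
      refine ⟨‖z‖ * P t, fun a => ?_⟩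
      rw [complexifyAction_tmul, one_mul, tmul_eq_smul_one_tmul, map_smul_eq_mul, mul_assoc]
      refine mul_le_mul_of_nonneg_left ?_ (norm_nonneg _)
      exact (hq _).trans ((hP a t).trans_eq (mul_comm _ _))

theorem exists_complexifyAction_le (hL : IsStarAction L) (hp : IsInvolutiveSeminorm p)
    (hP : ∀ a t, P (L a t) ≤ p a * P t) (hq : ∀ t, q ((1 : ℂ) ⊗ₜ t) ≤ P t) (e : ℂ ⊗[ℝ] A) :
    ∃ C, ∀ x, q (complexifyAction L e x) ≤ C * q x := by
  induction e with
  | zero => exact ⟨0, fun x => by simp⟩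
  | add e f he hf =>
    obtain ⟨C, hC⟩ := he
    obtain ⟨C', hC'⟩ := hf
    refine ⟨C + C', fun x => ?_⟩
    rw [map_add, LinearMap.add_apply, add_mul]
    exact (map_add_le_add q.toSeminorm _ _).trans (add_le_add (hC x) (hC' x))
  | tmul z a =>
    refine ⟨‖z‖ * p a, fun x => ?_⟩
    rw [tmul_eq_smul_one_tmul, map_smul, LinearMap.smul_apply, map_smul_eq_mul, mul_assoc]
    exact mul_le_mul_of_nonneg_left (complexifyAction_le hL hp hP hq a x) (norm_nonneg _)

/-- An action of `A` on `T` extends to a morphism from every universal completion of `A` to the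
multiplier algebra of a completion of `ℂ ⊗ T`. -/
theorem IsUniversalCompletion.exists_multiplierHom {C : Type*} [NonUnitalCStarAlgebra C]
    {η : A →⋆ₙₐ[ℝ] C} (hη : IsUniversalCompletion p η) (hL : IsStarAction L)
    (hp : IsInvolutiveSeminorm p) (hP : ∀ a t, P (L a t) ≤ p a * P t)
    (hq : ∀ t, q ((1 : ℂ) ⊗ₜ t) ≤ P t) :
    ∃ f : C →⋆ₙₐ[ℂ] 𝓜(ℂ, CStarCompletion q), ∀ e x,
      (f (complexify η e)).fst (CStarCompletion.mk q x) =
        CStarCompletion.mk q (EnvCStar.complexifyAction L e x) := by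
  have hb := exists_complexifyAction_le hL hp hP hq
  -- The multiplier norm is a C*-seminorm on `ℂ ⊗ A`. The sharp constant `p a` in
  -- `complexifyAction_le` is what allows maximality of `η` to be applied to it.
  obtain ⟨f, hf⟩ := exists_extension_of_denseRange (B := 𝓜(ℂ, CStarCompletion q)) hη.denseRange
    (hL.complexifyAction.multiplierHom hb)
    (hη.le_norm (.ofHom (C := 𝓜(ℂ, CStarCompletion q))
      (hL.complexifyAction.multiplierHom hb)) fun a => hL.complexifyAction.norm_multiplierHom_le hb
      (apply_nonneg _ _) (complexifyAction_le hL hp hP hq a))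
  exact ⟨f, fun e x => by rw [hf, IsStarAction.multiplierHom_fst_mk]⟩

end Complexify

/-! ### The maximal tensor product of universal completions -/

section Lift

variable {C₁ C₂ M : Type*} [NonUnitalCStarAlgebra C₁] [NonUnitalCStarAlgebra C₂]
  [NonUnitalCStarAlgebra M]

/-- The morphism `c ⊗ d ↦ f c * g d` induced by two morphisms with commuting ranges. -/
def tensorLift (f : C₁ →⋆ₙₐ[ℂ] M) (g : C₂ →⋆ₙₐ[ℂ] M) (h : ∀ c d, f c * g d = g d * f c) :
    C₁ ⊗[ℂ] C₂ →⋆ₙₐ[ℂ] M :=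
  let φ : C₁ ⊗[ℂ] C₂ →ₗ[ℂ] M :=
    TensorProduct.lift ((LinearMap.mul ℂ M).compl₁₂ (f : C₁ →ₗ[ℂ] M) (g : C₂ →ₗ[ℂ] M))
  have hφ : ∀ c d, φ (c ⊗ₜ d) = f c * g d := fun c d => rfl
  { toFun := φ
    map_smul' := map_smul φ
    map_zero' := map_zero φ
    map_add' := map_add φ
    map_mul' := fun x y => by
      induction x with
      | zero => simp
      | add x x' hx hx' => rw [add_mul, map_add, hx, hx', map_add, add_mul]
      | tmul c d =>
        induction y with
        | zero => simp
        | add x x' hx hx' => rw [mul_add, map_add, hx, hx', map_add, mul_add]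
        | tmul c' d' =>
          rw [Algebra.TensorProduct.tmul_mul_tmul, hφ, hφ, hφ, map_mul, map_mul, mul_assoc,
            ← mul_assoc (f c'), h c' d, mul_assoc, mul_assoc]
    map_star' := fun x => by
      induction x with
      | zero => simp
      | add x y hx hy => rw [star_add, map_add, hx, hy, map_add, star_add]
      | tmul c d => rw [TensorProduct.star_tmul, hφ, hφ, map_star, map_star, star_mul,
          ← map_star, ← map_star, h] }

/-- The supremum of all C*-seminorms is a true pointwise supremum, not the default value zero,
because `CStarSeminorm.tmul_le` bounds all of them uniformly on elementary tensors. -/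
theorem le_maxCStarSeminorm (q : CStarSeminorm (C₁ ⊗[ℂ] C₂)) (x : C₁ ⊗[ℂ] C₂) :
    q x ≤ maxCStarSeminorm C₁ C₂ x := by
  have hM : ∀ x : C₁ ⊗[ℂ] C₂, ∃ M, ∀ q : CStarSeminorm (C₁ ⊗[ℂ] C₂), q x ≤ M := fun x => by
    induction x with
    | zero => exact ⟨0, fun q => (map_zero q.toSeminorm).le⟩
    | tmul c d => exact ⟨_, fun q => q.tmul_le c d⟩
    | add x y hx hy =>
      obtain ⟨M, hM⟩ := hx
      obtain ⟨N, hN⟩ := hy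
      exact ⟨M + N, fun q => (map_add_le_add q.toSeminorm x y).trans (add_le_add (hM q) (hN q))⟩
  choose M hM using hM
  exact CStarSeminorm.le_sup (fun q _ x => hM x q) (Set.mem_univ q) x

/-- The universal property of the maximal C*-tensor product. -/
theorem exists_maxTensor_lift (f : C₁ →⋆ₙₐ[ℂ] M) (g : C₂ →⋆ₙₐ[ℂ] M)
    (h : ∀ c d, f c * g d = g d * f c) : ∃ ψ : MaxTensor C₁ C₂ →⋆ₙₐ[ℂ] M,
      ∀ c d, ψ (CStarCompletion.mk _ (c ⊗ₜ d)) = f c * g d :=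
  ⟨CStarCompletion.lift _ (tensorLift f g h) (le_maxCStarSeminorm (.ofHom (tensorLift f g h))),
    fun _ _ => CStarCompletion.lift_mk _ _ _ _⟩

theorem norm_mk_tmul_le (c : C₁) (d : C₂) :
    ‖CStarCompletion.mk (maxCStarSeminorm C₁ C₂) (c ⊗ₜ d)‖ ≤ ‖c‖ * ‖d‖ := by
  rw [CStarCompletion.norm_mk]
  exact CStarSeminorm.tmul_le _ c d

/-- A closed subspace of the maximal tensor product which contains the elementary tensors of
elements of dense subsets is the whole space. -/
theorem denseRange_of_tmul_mem {X₁ X₂ : Type*} {ι₁ : X₁ → C₁} {ι₂ : X₂ → C₂}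
    (h₁ : DenseRange ι₁) (h₂ : DenseRange ι₂) (S : Submodule ℂ (MaxTensor C₁ C₂))
    (hS : ∀ x y, CStarCompletion.mk (maxCStarSeminorm C₁ C₂) (ι₁ x ⊗ₜ ι₂ y) ∈ S) :
    Dense (S : Set (MaxTensor C₁ C₂)) := by
  -- The cross-norm bound makes `(c, d) ↦ c ⊗ d` continuous in each variable, so membership in the
  -- closure of `S` passes from the dense subsets to all elementary tensors.
  let b : C₁ →L[ℂ] C₂ →L[ℂ] MaxTensor C₁ C₂ :=
    ((TensorProduct.mk ℂ C₁ C₂).compr₂ (CStarCompletion.mkLinear _)).mkContinuous₂ 1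
      fun c d => by rw [one_mul]; exact norm_mk_tmul_le c d
  have hb : ∀ c d, b c d = CStarCompletion.mk _ (c ⊗ₜ d) := fun c d => rfl
  have hcl : IsClosed (S.topologicalClosure : Set (MaxTensor C₁ C₂)) :=
    S.isClosed_topologicalClosure
  have hmem : ∀ c d, b c d ∈ S.topologicalClosure := fun c d =>
    h₁.induction_on (p := fun c => b c d ∈ S.topologicalClosure) c
      (hcl.preimage (by fun_prop)) fun x =>
        h₂.induction_on (p := fun d => b (ι₁ x) d ∈ S.topologicalClosure) d
          (hcl.preimage (by fun_prop)) fun y => S.le_topologicalClosure (hS x y)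
  have hall : ∀ z, z ∈ S.topologicalClosure := CStarCompletion.induction _ hcl fun z => by
    induction z with
    | zero => rw [CStarCompletion.mk_zero]; exact zero_mem _
    | add z w hz hw => rw [CStarCompletion.mk_add]; exact add_mem hz hw
    | tmul c d => exact hmem c d
  intro z
  exact hall z

end Lift

/-! ### Commuting actions and comparison with the multiplier norm. -/

section Commuting

variable {A₁ A₂ T C₁ C₂ : Type*}
  [NonUnitalRing A₁] [Module ℝ A₁] [IsScalarTower ℝ A₁ A₁] [SMulCommClass ℝ A₁ A₁]
  [StarRing A₁] [StarModule ℝ A₁]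
  [NonUnitalRing A₂] [Module ℝ A₂] [IsScalarTower ℝ A₂ A₂] [SMulCommClass ℝ A₂ A₂]
  [StarRing A₂] [StarModule ℝ A₂]
  [NonUnitalRing T] [Module ℝ T] [IsScalarTower ℝ T T] [SMulCommClass ℝ T T]
  [StarRing T] [StarModule ℝ T]
  [NonUnitalCStarAlgebra C₁] [NonUnitalCStarAlgebra C₂]
  {q : CStarSeminorm (ℂ ⊗[ℝ] T)}

/-- Commuting actions of `A₁` and `A₂` on `T` induce a morphism from the maximal tensor product of
their universal completions to the multiplier algebra of a completion of `ℂ ⊗ T`. -/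
theorem exists_multiplierHom_of_commuting
    {p₁ : Seminorm ℝ A₁} {p₂ : Seminorm ℝ A₂} {P : Seminorm ℝ T}
    {η₁ : A₁ →⋆ₙₐ[ℝ] C₁} {η₂ : A₂ →⋆ₙₐ[ℝ] C₂}
    {L₁ : A₁ →ₗ[ℝ] T →ₗ[ℝ] T} {L₂ : A₂ →ₗ[ℝ] T →ₗ[ℝ] T}
    (hp₁ : IsInvolutiveSeminorm p₁) (hp₂ : IsInvolutiveSeminorm p₂)
    (h₁ : IsUniversalCompletion p₁ η₁) (h₂ : IsUniversalCompletion p₂ η₂)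
    (hL₁ : IsStarAction L₁) (hL₂ : IsStarAction L₂)
    (hP₁ : ∀ a t, P (L₁ a t) ≤ p₁ a * P t) (hP₂ : ∀ a t, P (L₂ a t) ≤ p₂ a * P t)
    (hL : ∀ e e' x, complexifyAction L₁ e (complexifyAction L₂ e' x) =
      complexifyAction L₂ e' (complexifyAction L₁ e x))
    (hq : ∀ t, q ((1 : ℂ) ⊗ₜ t) ≤ P t) :
    ∃ ψ : MaxTensor C₁ C₂ →⋆ₙₐ[ℂ] 𝓜(ℂ, CStarCompletion q), ∀ a b x,
      (ψ (CStarCompletion.mk _ (η₁ a ⊗ₜ η₂ b))).fst (CStarCompletion.mk q x) =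
        CStarCompletion.mk q (complexifyAction L₁ (1 ⊗ₜ a) (complexifyAction L₂ (1 ⊗ₜ b) x)) := by
  obtain ⟨f, hf⟩ := h₁.exists_multiplierHom (q := q) hL₁ hp₁ hP₁ hq
  obtain ⟨g, hg⟩ := h₂.exists_multiplierHom (q := q) hL₂ hp₂ hP₂ hq
  have hfc : Continuous f := continuous_of_cstar (B := 𝓜(ℂ, CStarCompletion q)) f
  have hgc : Continuous g := continuous_of_cstar (B := 𝓜(ℂ, CStarCompletion q)) g
  -- By density and continuity, commutation need only be checked on the images of the
  -- complexifications, where it is that of the two actions.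
  have hcomm : ∀ c d, f c * g d = g d * f c := fun c d =>
    h₁.denseRange.induction_on (p := fun c => f c * g d = g d * f c) c
      (isClosed_eq (by fun_prop) (by fun_prop)) fun e =>
        h₂.denseRange.induction_on
          (p := fun d => f (complexify η₁ e) * g d = g d * f (complexify η₁ e)) d
          (isClosed_eq (by fun_prop) (by fun_prop)) fun e' =>
            CStarCompletion.multiplier_ext fun x => by
              change (f _).fst ((g _).fst _) = (g _).fst ((f _).fst _)
              rw [hg, hf, hf, hg, hL]
  obtain ⟨ψ, hψ⟩ := exists_maxTensor_lift (M := 𝓜(ℂ, CStarCompletion q)) f g hcomm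
  refine ⟨ψ, fun a b x => ?_⟩
  have ha := hf (1 ⊗ₜ a)
  have hb := hg (1 ⊗ₜ b)
  rw [complexify_tmul, one_smul] at ha hb
  rw [hψ]
  change (f _).fst ((g _).fst _) = _
  rw [hb, ha]

/-- A C*-seminorm on `ℂ ⊗ T` is dominated by a morphism through which the left multiplication on
its completion factors. -/
theorem le_norm_complexify_of_multiplierHom {C : Type*} [NonUnitalCStarAlgebra C]
    {θ : T →⋆ₙₐ[ℝ] C} (ψ : C →⋆ₙₐ[ℂ] 𝓜(ℂ, CStarCompletion q))
    (hψ : ∀ t x, (ψ (θ t)).fst (CStarCompletion.mk q x) =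
      CStarCompletion.mk q (((1 : ℂ) ⊗ₜ t) * x)) (x : ℂ ⊗[ℝ] T) :
    q x ≤ ‖complexify θ x‖ := by
  -- Left multiplication embeds the completion isometrically into its multiplier algebra; on `ℂ ⊗ T`
  -- this embedding equals `ψ ∘ complexify θ`, and `ψ` is contractive.
  let m : ℂ ⊗[ℝ] T →⋆ₙₐ[ℂ] 𝓜(ℂ, CStarCompletion q) :=
    DoubleCentralizer.coeHom.comp (CStarCompletion.mkHom q)
  have hm : ∀ x, m x = ψ (complexify θ x) := fun x => by
    induction x with
    | zero => simp
    | add x y hx hy => rw [map_add, map_add, map_add, hx, hy]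
    | tmul z t =>
      rw [tmul_eq_smul_one_tmul, map_smul, map_smul, map_smul, complexify_tmul, one_smul]
      congr 1
      refine CStarCompletion.multiplier_ext fun x => ?_
      rw [hψ, CStarCompletion.mk_mul]
      rfl
  have hnorm : ‖m x‖ = q x := by
    rw [← DoubleCentralizer.norm_fst, ← CStarCompletion.norm_mk q x]
    exact ContinuousLinearMap.opNorm_mul_apply ℂ _ _
  rw [← hnorm, hm]
  exact NonUnitalStarAlgHom.norm_apply_le (B := 𝓜(ℂ, CStarCompletion q)) ψ _

end Commuting

/-! ### The two factor actions and the tensor product of universal completions. -/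

section Tensor

variable {A₁ A₂ : Type*}
  [NonUnitalRing A₁] [Module ℝ A₁] [IsScalarTower ℝ A₁ A₁] [SMulCommClass ℝ A₁ A₁]
  [NonUnitalRing A₂] [Module ℝ A₂] [IsScalarTower ℝ A₂ A₂] [SMulCommClass ℝ A₂ A₂]

variable (A₁ A₂) in
/-- The action of `A₁` on `A₁ ⊗ A₂` by left multiplication on the first factor. -/
def leftAction : A₁ →ₗ[ℝ] A₁ ⊗[ℝ] A₂ →ₗ[ℝ] A₁ ⊗[ℝ] A₂ :=
  LinearMap.rTensorHom A₂ ∘ₗ LinearMap.mul ℝ A₁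

variable (A₁ A₂) in
/-- The action of `A₂` on `A₁ ⊗ A₂` by left multiplication on the second factor. -/
def rightAction : A₂ →ₗ[ℝ] A₁ ⊗[ℝ] A₂ →ₗ[ℝ] A₁ ⊗[ℝ] A₂ :=
  LinearMap.lTensorHom A₁ ∘ₗ LinearMap.mul ℝ A₂

theorem leftAction_tmul (a x : A₁) (y : A₂) :
    leftAction A₁ A₂ a (x ⊗ₜ y) = (a * x) ⊗ₜ y := rfl

theorem rightAction_tmul (a y : A₂) (x : A₁) :
    rightAction A₁ A₂ a (x ⊗ₜ y) = x ⊗ₜ (a * y) := rfl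

theorem leftAction_le {p₁ : Seminorm ℝ A₁} (h : ∀ a b, p₁ (a * b) ≤ p₁ a * p₁ b)
    (p₂ : Seminorm ℝ A₂) (a : A₁) (z : A₁ ⊗[ℝ] A₂) :
    projSeminorm p₁ p₂ (leftAction A₁ A₂ a z) ≤ p₁ a * projSeminorm p₁ p₂ z :=
  le_mul_projSeminorm (r := fun z => projSeminorm p₁ p₂ (leftAction A₁ A₂ a z)) (apply_nonneg _ _)
    (by simp) (fun z w => by rw [map_add]; exact map_add_le_add _ _ _) (fun x y => by
      rw [leftAction_tmul, projSeminorm_tmul, ← mul_assoc]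
      exact mul_le_mul_of_nonneg_right (h a x) (apply_nonneg _ _)) z

theorem rightAction_le (p₁ : Seminorm ℝ A₁) {p₂ : Seminorm ℝ A₂}
    (h : ∀ a b, p₂ (a * b) ≤ p₂ a * p₂ b) (a : A₂) (z : A₁ ⊗[ℝ] A₂) :
    projSeminorm p₁ p₂ (rightAction A₁ A₂ a z) ≤ p₂ a * projSeminorm p₁ p₂ z :=
  le_mul_projSeminorm (r := fun z => projSeminorm p₁ p₂ (rightAction A₁ A₂ a z)) (apply_nonneg _ _)
    (by simp) (fun z w => by rw [map_add]; exact map_add_le_add _ _ _) (fun x y => by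
      rw [rightAction_tmul, projSeminorm_tmul, mul_left_comm]
      exact mul_le_mul_of_nonneg_left (h a y) (apply_nonneg _ _)) z

theorem complexify_leftAction_comm (e : ℂ ⊗[ℝ] A₁) (f : ℂ ⊗[ℝ] A₂) (x : ℂ ⊗[ℝ] (A₁ ⊗[ℝ] A₂)) :
    complexifyAction (leftAction A₁ A₂) e (complexifyAction (rightAction A₁ A₂) f x) =
      complexifyAction (rightAction A₁ A₂) f (complexifyAction (leftAction A₁ A₂) e x) := by
  induction e with
  | zero => simp
  | add e e' he he' => simp only [map_add, LinearMap.add_apply, he, he']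
  | tmul z a =>
    induction f with
    | zero => simp
    | add e e' he he' => simp only [map_add, LinearMap.add_apply, he, he']
    | tmul w b =>
      induction x with
      | zero => simp
      | add x y hx hy => simp only [map_add, hx, hy]
      | tmul v t =>
        simp only [complexifyAction_tmul]
        rw [mul_left_comm]
        congr 1
        induction t with
        | zero => simp
        | add s t hs ht => simp only [map_add, hs, ht]
        | tmul x y => simp only [leftAction_tmul, rightAction_tmul]

/-- Replaces the factorization `a ⊗ b = (a ⊗ 1) * (1 ⊗ b)`, which would need identities. -/
theorem complexify_leftAction_rightAction (a : A₁) (b : A₂) (x : ℂ ⊗[ℝ] (A₁ ⊗[ℝ] A₂)) :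
    complexifyAction (leftAction A₁ A₂) (1 ⊗ₜ a) (complexifyAction (rightAction A₁ A₂) (1 ⊗ₜ b) x) =
      (1 ⊗ₜ (a ⊗ₜ b)) * x := by
  induction x with
  | zero => simp
  | add x y hx hy => rw [map_add, map_add, hx, hy, mul_add]
  | tmul v t =>
    simp only [complexifyAction_tmul, one_mul, Algebra.TensorProduct.tmul_mul_tmul]
    congr 1
    induction t with
    | zero => simp
    | add s t hs ht => rw [map_add, map_add, hs, ht, mul_add]
    | tmul x y => rw [rightAction_tmul, leftAction_tmul, Algebra.TensorProduct.tmul_mul_tmul]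

variable [StarRing A₁] [StarModule ℝ A₁] [StarRing A₂] [StarModule ℝ A₂]

theorem isStarAction_leftAction : IsStarAction (leftAction A₁ A₂) where
  mul_apply a b z := by
    induction z with
    | zero => simp
    | add z w hz hw => rw [map_add, hz, hw, map_add, map_add]
    | tmul x y => rw [leftAction_tmul, leftAction_tmul, leftAction_tmul, mul_assoc]
  adjoint a z w := by
    induction z with
    | zero => simp
    | add z z' hz hz' => rw [map_add, star_add, star_add, add_mul, add_mul, hz, hz']
    | tmul x y =>
      induction w with
      | zero => simp
      | add z z' hz hz' => rw [mul_add, map_add, mul_add, hz, hz']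
      | tmul x' y' =>
        simp only [leftAction_tmul, TensorProduct.star_tmul, Algebra.TensorProduct.tmul_mul_tmul,
          star_mul, mul_assoc]

theorem isStarAction_rightAction : IsStarAction (rightAction A₁ A₂) where
  mul_apply a b z := by
    induction z with
    | zero => simp
    | add z w hz hw => rw [map_add, hz, hw, map_add, map_add]
    | tmul x y => rw [rightAction_tmul, rightAction_tmul, rightAction_tmul, mul_assoc]
  adjoint a z w := by
    induction z with
    | zero => simp
    | add z z' hz hz' => rw [map_add, star_add, star_add, add_mul, add_mul, hz, hz']
    | tmul x y =>
      induction w with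
      | zero => simp
      | add z z' hz hz' => rw [mul_add, map_add, mul_add, hz, hz']
      | tmul x' y' =>
        simp only [rightAction_tmul, TensorProduct.star_tmul, Algebra.TensorProduct.tmul_mul_tmul,
          star_mul, mul_assoc]

variable {C₁ C₂ : Type*} [NonUnitalCStarAlgebra C₁] [NonUnitalCStarAlgebra C₂]
  {p₁ : Seminorm ℝ A₁} {p₂ : Seminorm ℝ A₂} {η₁ : A₁ →⋆ₙₐ[ℝ] C₁} {η₂ : A₂ →⋆ₙₐ[ℝ] C₂}

theorem tensorHom_tmul (x : A₁) (y : A₂) :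
    tensorHom η₁ η₂ (x ⊗ₜ y) = CStarCompletion.mk (maxCStarSeminorm C₁ C₂) (η₁ x ⊗ₜ η₂ y) := rfl

theorem norm_tensorHom_le (h₁ : ∀ a, ‖η₁ a‖ ≤ p₁ a) (h₂ : ∀ a, ‖η₂ a‖ ≤ p₂ a)
    (z : A₁ ⊗[ℝ] A₂) : ‖tensorHom η₁ η₂ z‖ ≤ projSeminorm p₁ p₂ z := by
  rw [← one_mul (projSeminorm p₁ p₂ z)]
  refine le_mul_projSeminorm (r := fun z => ‖tensorHom η₁ η₂ z‖) zero_le_one (by simp)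
    (fun z w => by rw [map_add]; exact norm_add_le _ _) (fun x y => ?_) z
  rw [tensorHom_tmul, one_mul]
  exact (norm_mk_tmul_le _ _).trans
    (mul_le_mul (h₁ x) (h₂ y) (norm_nonneg _) (apply_nonneg _ _))

/-- The range is a subspace containing `complexify η₁ x ⊗ complexify η₂ y` for all `x`, `y`, so
`denseRange_of_tmul_mem` applies. -/
theorem denseRange_complexify_tensorHom (h₁ : DenseRange (complexify η₁))
    (h₂ : DenseRange (complexify η₂)) : DenseRange (complexify (tensorHom η₁ η₂)) := by
  have key : ∀ x y, CStarCompletion.mk (maxCStarSeminorm C₁ C₂)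
      (complexify η₁ x ⊗ₜ complexify η₂ y) ∈
        LinearMap.range (complexify (tensorHom η₁ η₂) : ℂ ⊗[ℝ] (A₁ ⊗[ℝ] A₂) →ₗ[ℂ] _) := by
    intro x y
    induction x with
    | zero => rw [map_zero, TensorProduct.zero_tmul, CStarCompletion.mk_zero]; exact zero_mem _
    | add x x' hx hx' =>
      rw [map_add, TensorProduct.add_tmul, CStarCompletion.mk_add]
      exact add_mem hx hx'
    | tmul z a =>
      induction y with
      | zero => rw [map_zero, TensorProduct.tmul_zero, CStarCompletion.mk_zero]; exact zero_mem _
      | add x x' hx hx' =>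
        rw [map_add, TensorProduct.tmul_add, CStarCompletion.mk_add]
        exact add_mem hx hx'
      | tmul w b =>
        refine ⟨(z * w) ⊗ₜ (a ⊗ₜ b), ?_⟩
        change complexify (tensorHom η₁ η₂) ((z * w) ⊗ₜ (a ⊗ₜ b)) = _
        rw [complexify_tmul, complexify_tmul, complexify_tmul, tensorHom_tmul,
          TensorProduct.smul_tmul_smul, CStarCompletion.mk_smul]
  exact denseRange_of_tmul_mem h₁ h₂ _ key

theorem IsUniversalCompletion.tensorHom (hp₁ : IsInvolutiveSeminorm p₁)
    (hp₂ : IsInvolutiveSeminorm p₂) (h₁ : IsUniversalCompletion p₁ η₁)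
    (h₂ : IsUniversalCompletion p₂ η₂) :
    IsUniversalCompletion (projSeminorm p₁ p₂) (tensorHom η₁ η₂) := by
  refine ⟨norm_tensorHom_le h₁.norm_le h₂.norm_le,
    denseRange_complexify_tensorHom h₁.denseRange h₂.denseRange, fun q hq => ?_⟩
  obtain ⟨ψ, hψ⟩ := exists_multiplierHom_of_commuting hp₁ hp₂ h₁ h₂ isStarAction_leftAction
    isStarAction_rightAction (leftAction_le hp₁.mul_le p₂) (rightAction_le p₁ hp₂.mul_le)
    complexify_leftAction_comm hq
  -- It remains to identify `ψ (tensorHom η₁ η₂ t)` with left multiplication by `1 ⊗ t`; both are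
  -- additive in `t`, so elementary tensors suffice.
  refine le_norm_complexify_of_multiplierHom ψ fun t x => ?_
  induction t with
  | zero => simp [CStarCompletion.mk_zero]
  | add s t hs ht =>
    rw [TensorProduct.tmul_add, add_mul, CStarCompletion.mk_add, ← hs, ← ht, map_add, map_add]
    rfl
  | tmul a b => rw [tensorHom_tmul, hψ, complexify_leftAction_rightAction]

end Tensor

/-! ### Tensor powers by induction. -/

section Powers

variable {A : Type u} [NonUnitalRing A] [Module ℝ A] [IsScalarTower ℝ A A] [SMulCommClass ℝ A A]
  [StarRing A] [StarModule ℝ A] {C : Type*} [NonUnitalCStarAlgebra C]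

theorem IsInvolutiveSeminorm.powSeminorm {p : Seminorm ℝ A} (hp : IsInvolutiveSeminorm p) :
    ∀ n, IsInvolutiveSeminorm (powSeminorm p n)
  | 0 => hp
  | n + 1 => (IsInvolutiveSeminorm.powSeminorm hp n).projSeminorm hp

theorem IsUniversalCompletion.powHom {p : Seminorm ℝ A} (hp : IsInvolutiveSeminorm p)
    {η : A →⋆ₙₐ[ℝ] C} (h : IsUniversalCompletion p η) :
    ∀ n, IsUniversalCompletion (powSeminorm p n) (powHom η n)
  | 0 => h
  | n + 1 => (IsUniversalCompletion.powHom hp h n).tensorHom (hp.powSeminorm n) hp h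

end Powers

end EnvCStar

end

theorem mainTheorem7
    {A₁ : Type u₁} [NonUnitalRing A₁] [Module ℝ A₁] [IsScalarTower ℝ A₁ A₁]
    [SMulCommClass ℝ A₁ A₁] [StarRing A₁] [StarModule ℝ A₁]
    {A₂ : Type u₂} [NonUnitalRing A₂] [Module ℝ A₂] [IsScalarTower ℝ A₂ A₂]
    [SMulCommClass ℝ A₂ A₂] [StarRing A₂] [StarModule ℝ A₂]
    {A : Type u} [NonUnitalRing A] [Module ℝ A] [IsScalarTower ℝ A A]
    [SMulCommClass ℝ A A] [StarRing A] [StarModule ℝ A]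
    (p₁ : Seminorm ℝ A₁) (hp₁ : EnvCStar.IsInvolutiveSeminorm p₁)
    (p₂ : Seminorm ℝ A₂) (hp₂ : EnvCStar.IsInvolutiveSeminorm p₂)
    (p : Seminorm ℝ A) (hp : EnvCStar.IsInvolutiveSeminorm p) :
    (EnvCStar.IsInvolutiveSeminorm (EnvCStar.projSeminorm p₁ p₂) ∧
      EnvCStar.IsEnvelopingCStar.{max u₁ u₂, w} (EnvCStar.projSeminorm p₁ p₂)
        (EnvCStar.tensorHom (EnvCStar.toEnveloping p₁) (EnvCStar.toEnveloping p₂))) ∧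
    (∀ n : ℕ, EnvCStar.IsInvolutiveSeminorm (EnvCStar.powSeminorm p n) ∧
      EnvCStar.IsEnvelopingCStar.{u, w} (EnvCStar.powSeminorm p n)
        (EnvCStar.powHom (EnvCStar.toEnveloping p) n)) ∧
    EnvCStar.IsEnvelopingCStar.{0, w} (normSeminorm ℝ ℝ)
      ((StarAlgHom.ofId ℝ ℂ : ℝ →⋆ₐ[ℝ] ℂ) : ℝ →⋆ₙₐ[ℝ] ℂ) := by
  exact ⟨⟨hp₁.projSeminorm hp₂,
      ((EnvCStar.isUniversalCompletion_toEnveloping p₁).tensorHom hp₁ hp₂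
        (EnvCStar.isUniversalCompletion_toEnveloping p₂)).isEnvelopingCStar⟩,
    -- Index `n` stands for the tensor power of exponent `n + 1`; exponent zero is the separate last
    -- component.
    fun n => ⟨hp.powSeminorm n,
      ((EnvCStar.isUniversalCompletion_toEnveloping p).powHom hp n).isEnvelopingCStar⟩,
    EnvCStar.isUniversalCompletion_real.isEnvelopingCStar⟩
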